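/- **Theorem (second-order pointwise estimates).** Let $n\ge 2$ and let $\Omega\subset\mathbb R^n$ be any open set. Denote by $\mathcal H^{n-1}$ the $(n-1)$-dimensional Hausdorff measure and by $\mathbb S^{n-1}$ the unit sphere of $\mathbb R^n$. *Notation.* - $V^2L^1(\Omega)$ is the space of functions $u$ that are twice weakly differentiable in $\Omega$ with $|\nabla^2u|\in L^1(\Omega)$, where $\nabla^2u$ is the matrix of all second-order weak derivatives of $u$. No further integrability of $u$ or $\nabla u$ is required. - $C_b(\overline\Omega)$ is the space of continuous functions on $\overline\Omega$ with bounded support. The restriction of $u\in C_b(\overline\Omega)$ to $\partial\Omega$ is denoted by $u_{\partial\Omega}$. - A Hajłasz gradient of $\varphi:\partial\Omega\to\mathbb R$ is a Borel function $g:\partial\Omega\to\mathbb R$ for which there is a set $N\subset\partial\Omega$ with $\mathcal H^{n-1}(N)=0$ such that $|\varphi(x)-\varphi(y)|\le |x-y|\,(g(x)+g(y))$ for all $x,y\in\partial\Omega\setminus N$. (Since $n\ge2$, such a $g$ is nonnegative $\mathcal H^{n-1}$-a.e.) - $u\in\mathcal V^1L^1(\partial\Omega)$ means that $u_{\partial\Omega}$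 has a Hajłasz gradient in $L^1(\partial\Omega,\mathcal H^{n-1})$. - For $x\in\Omega$ and $\vartheta\in\mathbb S^{n-1}$ such that the half-line $\{x+t\vartheta:t>0\}$ meets $\partial\Omega$, $\zeta(x,\vartheta)$ is the first point of this half-line on $\partial\Omega$. For $\varphi:\partial\Omega\to\mathbb R$ we set $\varphi(\zeta(x,\vartheta))=0$ if the half-line does not meet $\partial\Omega$. (i) If $n\ge3$, there is a constant $C$, depending only on $n$, such that for every $u\in V^2L^1(\Omega)\cap\mathcal V^1L^1(\partial\Omega)\cap C_b(\overline\Omega)$ and every Hajłasz gradient $g_u$ of $u_{\partial\Omega}$, $$|u(x)|\le C\bigg(\int_\Omega\frac{|\nabla^2u(y)|}{|x-y|^{n-2}}\,dy+\int_\Omega\int_{\mathbb S^{n-1}}\frac{g_u(\zeta(y,\vartheta))}{|x-y|^{n-1}}\,d\mathcal H^{n-1}(\vartheta)\,dy+\int_{\mathbb S^{n-1}}|u_{\partial\Omega}(\zeta(x,\vartheta))|\,d\mathcal H^{n-1}(\vartheta)\bigg)\quad\text{for every }x\in\Omega.$$ (ii) If $n\ge2$, there is a constant $C$, depending only on $n$,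 such that for every $u\in V^2L^1(\Omega)\cap\mathcal V^1L^1(\partial\Omega)\cap C_b(\overline\Omega)$ and every Hajłasz gradient $g_u$ of $u_{\partial\Omega}$, $$|\nabla u(x)|\le C\bigg(\int_\Omega\frac{|\nabla^2u(y)|}{|x-y|^{n-1}}\,dy+\int_{\mathbb S^{n-1}}g_u(\zeta(x,\vartheta))\,d\mathcal H^{n-1}(\vartheta)\bigg)\quad\text{for a.e. }x\in\Omega.$$ In both parts the constant does not depend on $\Omega$, and the right-hand sides may be infinite. -/

import Mathlib

open MeasureTheory Set
open scoped ContDiff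

/-! ### Weak derivatives on an open set `Ω ⊆ ℝⁿ` -/

/-- `v` is the weak `i`-th partial derivative of `u` in `Ω`:
both are locally integrable in `Ω`, and `∫_Ω u ∂ᵢφ = - ∫_Ω v φ` for every `φ ∈ C_c^∞(Ω)`. -/
def IsWeakPartial {n : ℕ} (Ω : Set (EuclideanSpace ℝ (Fin n)))
    (u v : EuclideanSpace ℝ (Fin n) → ℝ) (i : Fin n) : Prop :=
  LocallyIntegrableOn u Ω volume ∧ LocallyIntegrableOn v Ω volume ∧
    ∀ φ : EuclideanSpace ℝ (Fin n) → ℝ, ContDiff ℝ ∞ φ → HasCompactSupport φ → tsupport φ ⊆ Ω →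
      ∫ x in Ω, u x * fderiv ℝ φ x (EuclideanSpace.single i 1) = - ∫ x in Ω, v x * φ x

/-- `G` is (a representative of) the weak gradient `∇u` of `u` in `Ω`. -/
def IsWeakGradient {n : ℕ} (Ω : Set (EuclideanSpace ℝ (Fin n)))
    (u : EuclideanSpace ℝ (Fin n) → ℝ)
    (G : EuclideanSpace ℝ (Fin n) → EuclideanSpace ℝ (Fin n)) : Prop :=
  ∀ i : Fin n, IsWeakPartial Ω u (fun x => G x i) i

/-- `H` is (a representative of) the matrix `∇²u` of the weak second-order derivatives of `u`
in `Ω`. -/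
def IsWeakHessian {n : ℕ} (Ω : Set (EuclideanSpace ℝ (Fin n)))
    (u : EuclideanSpace ℝ (Fin n) → ℝ)
    (H : EuclideanSpace ℝ (Fin n) → Matrix (Fin n) (Fin n) ℝ) : Prop :=
  ∃ G : EuclideanSpace ℝ (Fin n) → EuclideanSpace ℝ (Fin n), IsWeakGradient Ω u G ∧
    ∀ i j : Fin n, IsWeakPartial Ω (fun x => G x i) (fun x => H x i j) j

/-- The Euclidean (Frobenius) norm `|A|` of a matrix. -/
noncomputable def matrixAbs {n : ℕ} (A : Matrix (Fin n) (Fin n) ℝ) : ℝ :=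
  Real.sqrt (∑ i, ∑ j, A i j ^ 2)

/-- `u ∈ V²L¹(Ω)`: `u` is twice weakly differentiable in `Ω` and `|∇²u| ∈ L¹(Ω)`.
Nothing is required of the integrability of `u` or `∇u` beyond local integrability. -/
def MemV2L1 {n : ℕ} (Ω : Set (EuclideanSpace ℝ (Fin n)))
    (u : EuclideanSpace ℝ (Fin n) → ℝ) : Prop :=
  ∃ H : EuclideanSpace ℝ (Fin n) → Matrix (Fin n) (Fin n) ℝ,
    IsWeakHessian Ω u H ∧ IntegrableOn (fun x => matrixAbs (H x)) Ω volume

/-- `u ∈ C_b(Ω̄)`: `u` is continuous on the closure of `Ω` and has bounded support there. -/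
def MemCb {n : ℕ} (Ω : Set (EuclideanSpace ℝ (Fin n)))
    (u : EuclideanSpace ℝ (Fin n) → ℝ) : Prop :=
  ContinuousOn u (closure Ω) ∧ Bornology.IsBounded {x ∈ closure Ω | u x ≠ 0}

/-! ### Hajłasz gradients on the boundary

Functions on `∂Ω` are represented by functions on `ℝⁿ` of which only the values on `∂Ω` are
ever used. -/

/-- `g : ∂Ω → ℝ` is a Hajłasz (upper) gradient of `φ : ∂Ω → ℝ`: it is Borel, and
`|φ x - φ y| ≤ |x - y| (g x + g y)` for all `x, y ∈ ∂Ω` outside an `ℋ^{n-1}`-null set. -/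
def IsHajlaszGradient {n : ℕ} (Ω : Set (EuclideanSpace ℝ (Fin n)))
    (φ g : EuclideanSpace ℝ (Fin n) → ℝ) : Prop :=
  Measurable (fun y : frontier Ω => g y) ∧
    ∃ N : Set (EuclideanSpace ℝ (Fin n)), N ⊆ frontier Ω ∧ μH[(n : ℝ) - 1] N = 0 ∧
      ∀ x ∈ frontier Ω \ N, ∀ y ∈ frontier Ω \ N, |φ x - φ y| ≤ ‖x - y‖ * (g x + g y)

/-- `φ ∈ 𝒱¹L¹(∂Ω)`: `φ` has a Hajłasz gradient in `L¹(∂Ω, ℋ^{n-1})`. -/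
def MemHajlaszV1L1 {n : ℕ} (Ω : Set (EuclideanSpace ℝ (Fin n)))
    (φ : EuclideanSpace ℝ (Fin n) → ℝ) : Prop :=
  ∃ g : EuclideanSpace ℝ (Fin n) → ℝ,
    IsHajlaszGradient Ω φ g ∧ IntegrableOn g (frontier Ω) μH[(n : ℝ) - 1]

/-! ### The first boundary point seen from `x` in the direction `ϑ` -/

/-- The set `{t > 0 : x + t ϑ ∈ ∂Ω}`. The pair `(x, ϑ)` belongs to `(Ω × 𝕊^{n-1})₀` exactly when
this set is nonempty. -/
def hitTimes {n : ℕ} (Ω : Set (EuclideanSpace ℝ (Fin n)))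
    (x θ : EuclideanSpace ℝ (Fin n)) : Set ℝ :=
  {t : ℝ | 0 < t ∧ x + t • θ ∈ frontier Ω}

/-- `ζ(x, ϑ)`, the first point of the half-line `{x + t ϑ : t > 0}` on `∂Ω`
(meaningful if the half-line meets `∂Ω`). -/
noncomputable def zeta {n : ℕ} (Ω : Set (EuclideanSpace ℝ (Fin n)))
    (x θ : EuclideanSpace ℝ (Fin n)) : EuclideanSpace ℝ (Fin n) :=
  x + sInf (hitTimes Ω x θ) • θ

open Classical in
/-- `φ(ζ(x, ϑ))` for `φ : ∂Ω → ℝ`, with the convention that it is `0` if the half-line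
`{x + t ϑ : t > 0}` does not meet `∂Ω`. -/
noncomputable def compZeta {n : ℕ} (Ω : Set (EuclideanSpace ℝ (Fin n)))
    (φ : EuclideanSpace ℝ (Fin n) → ℝ) (x θ : EuclideanSpace ℝ (Fin n)) : ℝ :=
  if (hitTimes Ω x θ).Nonempty then φ (zeta Ω x θ) else 0

/-- `(∂Ω)_x`, the part of `∂Ω` that can be seen from `x`. -/
def visibleBoundary {n : ℕ} (Ω : Set (EuclideanSpace ℝ (Fin n)))
    (x : EuclideanSpace ℝ (Fin n)) : Set (EuclideanSpace ℝ (Fin n)) :=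
  {y ∈ frontier Ω | ∀ t ∈ Ioo (0 : ℝ) 1, (1 - t) • x + t • y ∈ Ω}

/-- `ζ(x, ϑ)` is the unique point of the half-line that lies in `(∂Ω)_x`. -/
theorem add_smul_mem_visibleBoundary_iff {n : ℕ} {Ω : Set (EuclideanSpace ℝ (Fin n))}
    (hΩ : IsOpen Ω) {x θ : EuclideanSpace ℝ (Fin n)} (hx : x ∈ Ω)
    (hne : (hitTimes Ω x θ).Nonempty) {t : ℝ} (ht : 0 < t) :
    x + t • θ ∈ visibleBoundary Ω x ↔ t = sInf (hitTimes Ω x θ) := by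
  have hdisj : ∀ y ∈ Ω, y ∉ frontier Ω := fun y hy hf => by
    rw [hΩ.frontier_eq] at hf; exact hf.2 hy
  have hcont : Continuous fun s : ℝ => x + s • θ := by fun_prop
  have heq : hitTimes Ω x θ = Ici 0 ∩ (fun s : ℝ => x + s • θ) ⁻¹' frontier Ω := by
    ext s
    constructor
    · rintro ⟨h1, h2⟩; exact ⟨h1.le, h2⟩
    · rintro ⟨h1, h2⟩
      refine ⟨lt_of_le_of_ne h1 ?_, h2⟩
      rintro rfl
      exact hdisj x hx (by simpa using h2)
  have hclosed : IsClosed (hitTimes Ω x θ) := by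
    rw [heq]; exact isClosed_Ici.inter (isClosed_frontier.preimage hcont)
  have hbdd : BddBelow (hitTimes Ω x θ) := ⟨0, fun s hs => hs.1.le⟩
  have hT := hclosed.csInf_mem hne hbdd
  set T := sInf (hitTimes Ω x θ) with hTdef
  have key : ∀ s, 0 ≤ s → s < T → x + s • θ ∈ Ω := by
    intro s hs hsT
    by_contra hc
    have hpre : IsPreconnected ((fun s : ℝ => x + s • θ) '' Icc 0 s) :=
      isPreconnected_Icc.image _ hcont.continuousOn
    have hnf : ∀ r ∈ Icc 0 s, x + r • θ ∉ frontier Ω := by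
      intro r hr hrf
      have hr' : r ∈ hitTimes Ω x θ := by rw [heq]; exact ⟨hr.1, hrf⟩
      have := csInf_le hbdd hr'
      rw [← hTdef] at this
      linarith [hr.2]
    have hout : ∀ r ∈ Icc 0 s, x + r • θ ∉ Ω → x + r • θ ∈ (closure Ω)ᶜ := by
      intro r hr h1 h2
      exact hnf r hr (by rw [hΩ.frontier_eq]; exact ⟨h2, h1⟩)
    obtain ⟨y, -, hy1, hy2⟩ := hpre Ω (closure Ω)ᶜ hΩ isClosed_closure.isOpen_compl
      (by
        rintro _ ⟨r, hr, rfl⟩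
        by_cases h : x + r • θ ∈ Ω
        · exact Or.inl h
        · exact Or.inr (hout r hr h))
      ⟨x, ⟨0, ⟨le_rfl, hs⟩, by simp⟩, hx⟩
      ⟨_, ⟨s, ⟨hs, le_rfl⟩, rfl⟩, hout s ⟨hs, le_rfl⟩ hc⟩
    exact hy2 (subset_closure hy1)
  have hcomb : ∀ a s : ℝ, (1 - a) • x + a • (x + s • θ) = x + (a * s) • θ := by
    intro a s; module
  constructor
  · rintro ⟨h1, h2⟩
    have hle : T ≤ t := csInf_le hbdd ⟨ht, h1⟩
    by_contra hcon
    have hlt : T < t := lt_of_le_of_ne hle (Ne.symm hcon)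
    have h3 := h2 (T / t) ⟨div_pos hT.1 ht, (div_lt_one ht).2 hlt⟩
    rw [hcomb, div_mul_cancel₀ _ ht.ne'] at h3
    exact hdisj _ h3 hT.2
  · rintro rfl
    refine ⟨hT.2, fun a ha => ?_⟩
    rw [hcomb]
    exact key _ (mul_nonneg ha.1.le hT.1.le) (by nlinarith [ha.2, hT.1])

section

open scoped ENNReal NNReal Topology Pointwise
open Filter Metric

/-! For the gradient estimate, fix `x` and a direction `θ`, and follow the two opposite rays from
`x` to their first boundary points, at distances `T` and `T'`. Taylor's formula on the two rays
bounds `u (ζ x θ) - u x - T * c` and `u (ζ x (-θ)) - u x + T' * c` by `T` and `T'` times the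
integral of `|∇²u|` along the respective ray, where `c` is the component of `∇u x` along `θ`.
Subtraction eliminates `u x`. The two boundary points lie exactly `T + T'` apart, so the Hajłasz
inequality carries the same factor as `c`, and dividing by `T + T'` bounds `|c|` by the two ray
integrals plus the two boundary values of `g` (`abs_le_of_two_rays`). If a ray misses the boundary,
bounded support makes `u` vanish far out and `|c|` is bounded by the integral along that ray alone.
Averaging over `θ` recovers `‖∇u x‖` (`norm_smul_le_lintegral_inner`), and polar coordinates turn
ray integrals into the potential with kernel `|x - y|^{1-n}` (`lintegral_mul_rieszKernel`).

For the estimate of `u`, the first-order formula along one ray, averaged over `θ`, bounds `|u x|` by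
the boundary term plus the Riesz potential of `|∇u|`. The gradient estimate is inserted there, and
two kernels of exponent `1 - n` compose to one of exponent `2 - n`
(`exists_lintegral_rieszKernel_mul_le`). That composition converges at infinity only for `n ≥ 3`.

Since the derivatives are weak, the ray inequalities come from cutoffs and mollification. Mollifiers
are chosen so fast that the `L¹` errors are summable; the Riesz potential of their sum is then
finite almost everywhere, so the errors tend to zero in `L¹` along almost every ray. The first-order
inequality holds from every `x`, because a truncated ray avoids the kernel's singularity and `u` is
continuous. The second-order one also needs the mollified gradients to converge at `x`, hence holds
for almost every `x`.

Integration over directions uses the cone measure `toSphere`. It is dominated by Hausdorff measure,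
which suffices both for the right-hand sides and for discarding the exceptional set of the Hajłasz
gradient. -/

/-- Euclidean space of dimension `n`. -/
abbrev Euc (n : ℕ) := EuclideanSpace ℝ (Fin n)

/-! ### The cone measure on the unit sphere -/

variable {n : ℕ}

/-- The surface measure on the unit sphere, as a measure on the whole space. -/
noncomputable def sphereMeasure (n : ℕ) : Measure (Euc n) :=
  (volume : Measure (Euc n)).toSphere.map Subtype.val


instance : IsFiniteMeasure (sphereMeasure n) := by
  unfold sphereMeasure; infer_instance

theorem ae_sphereMeasure_norm_eq_one : ∀ᵐ θ ∂sphereMeasure n, ‖θ‖ = 1 := by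
  have hm : MeasurableSet {θ : Euc n | ‖θ‖ = 1} :=
    measurableSet_eq_fun measurable_norm measurable_const
  rw [sphereMeasure, ae_map_iff measurable_subtype_coe.aemeasurable hm]
  exact Eventually.of_forall fun θ => by simp

theorem lintegral_polar (hn : 0 < n) {f : Euc n → ℝ≥0∞} (hf : Measurable f) :
    ∫⁻ y, f y = ∫⁻ θ, (∫⁻ t in Ioi (0 : ℝ), f (t • θ) * ENNReal.ofReal (t ^ (n - 1)))
      ∂sphereMeasure n := by
  have : Nonempty (Fin n) := ⟨⟨0, hn⟩⟩
  have : Nontrivial (Euc n) := inferInstance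
  have hd : Module.finrank ℝ (Euc n) = n := by simp
  have h1 : ∫⁻ y, f y = ∫⁻ y : ({0}ᶜ : Set (Euc n)), f y ∂(volume.comap Subtype.val) := by
    rw [lintegral_subtype_comap (measurableSet_singleton _).compl,
      Measure.restrict_eq_self_of_ae_mem (by simp [ae_iff])]
  have hmp := (volume : Measure (Euc n)).measurePreserving_homeomorphUnitSphereProd
  have h2 := hmp.symm (homeomorphUnitSphereProd (Euc n)).toMeasurableEquiv
  have hmeas : Measurable fun y : ({0}ᶜ : Set (Euc n)) => f y :=
    hf.comp measurable_subtype_coe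
  rw [h1, ← h2.lintegral_comp hmeas]
  have hmeas2 : Measurable fun p : Euc n × ℝ =>
      f (p.2 • p.1) * ENNReal.ofReal (p.2 ^ (n - 1)) := by fun_prop
  have hm3 : Measurable fun p : sphere (0 : Euc n) 1 × Ioi (0 : ℝ) =>
      f ((homeomorphUnitSphereProd (Euc n)).toMeasurableEquiv.symm p : ({0}ᶜ : Set (Euc n))) :=
    hmeas.comp (MeasurableEquiv.measurable _)
  rw [lintegral_prod _ hm3.aemeasurable, sphereMeasure,
    lintegral_map (Measurable.lintegral_prod_right' hmeas2) measurable_subtype_coe]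
  refine lintegral_congr fun θ => ?_
  rw [Measure.volumeIoiPow, lintegral_withDensity_eq_lintegral_mul _ (by fun_prop) (by fun_prop),
    ← lintegral_subtype_comap measurableSet_Ioi
      (f := fun t : ℝ => f (t • (θ : Euc n)) * ENNReal.ofReal (t ^ (n - 1)))]
  refine lintegral_congr fun t => ?_
  simp [hd, mul_comm]

/-- The cone measure of `s` is a multiple of the volume of the cone over `s`, and volume is
invariant under negation. The symmetry lets the two opposite rays contribute equally after
integration in `θ`. -/
theorem map_neg_sphereMeasure : (sphereMeasure n).map Neg.neg = sphereMeasure n := by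
  ext s hs
  rw [Measure.map_apply measurable_neg hs, sphereMeasure,
    Measure.map_apply measurable_subtype_coe (measurable_neg hs),
    Measure.map_apply measurable_subtype_coe hs,
    Measure.toSphere_apply' _ (measurable_subtype_coe (measurable_neg hs)),
    Measure.toSphere_apply' _ (measurable_subtype_coe hs)]
  congr 1
  have : Ioo (0 : ℝ) 1 • ((Subtype.val : sphere (0 : Euc n) 1 → Euc n) ''
        (Subtype.val ⁻¹' (Neg.neg ⁻¹' s)))
      = Neg.neg ⁻¹' (Ioo (0 : ℝ) 1 • ((Subtype.val : sphere (0 : Euc n) 1 → Euc n) ''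
        (Subtype.val ⁻¹' s))) := by
    ext y
    simp only [Set.mem_smul, mem_preimage, Subtype.image_preimage_coe, mem_inter_iff]
    constructor
    · rintro ⟨t, ht, z, ⟨hz, hz'⟩, rfl⟩
      exact ⟨t, ht, -z, ⟨by simpa using hz, hz'⟩, by simp⟩
    · rintro ⟨t, ht, z, ⟨hz, hz'⟩, h⟩
      exact ⟨t, ht, -z, ⟨by simpa using hz, by simpa using hz'⟩, by simp [h]⟩
  rw [this]
  exact Measure.measure_preimage_neg _ _

theorem measurePreserving_neg_sphereMeasure :
    MeasurePreserving Neg.neg (sphereMeasure n) (sphereMeasure n) :=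
  ⟨measurable_neg, map_neg_sphereMeasure⟩

theorem lintegral_neg_sphereMeasure (f : Euc n → ℝ≥0∞) :
    ∫⁻ θ, f (-θ) ∂sphereMeasure n = ∫⁻ θ, f θ ∂sphereMeasure n :=
  measurePreserving_neg_sphereMeasure.lintegral_comp_emb
    (MeasurableEquiv.neg (Euc n)).measurableEmbedding f

theorem ae_neg_sphereMeasure {p : Euc n → Prop} (h : ∀ᵐ θ ∂sphereMeasure n, p θ) :
    ∀ᵐ θ ∂sphereMeasure n, p (-θ) :=
  measurePreserving_neg_sphereMeasure.quasiMeasurePreserving.ae h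

theorem sphereMeasure_univ_ne_zero (hn : 0 < n) : sphereMeasure n univ ≠ 0 := by
  have : Nonempty (Fin n) := ⟨⟨0, hn⟩⟩
  have : Nontrivial (Euc n) := inferInstance
  rw [sphereMeasure, Measure.map_apply measurable_subtype_coe .univ]
  rw [preimage_univ]
  exact (Measure.measure_univ_ne_zero).2 (volume : Measure (Euc n)).toSphere_ne_zero

/-- The Riesz kernel `|x - y|^{1-n}`. -/
noncomputable def rieszKernel (x y : Euc n) : ℝ≥0∞ := ENNReal.ofReal (1 / ‖x - y‖ ^ (n - 1))

@[fun_prop]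
theorem measurable_rieszKernel : Measurable fun p : Euc n × Euc n => rieszKernel p.1 p.2 := by
  unfold rieszKernel; fun_prop

theorem rieszKernel_comm (x y : Euc n) : rieszKernel x y = rieszKernel y x := by
  rw [rieszKernel, rieszKernel, norm_sub_rev]

/-- In polar coordinates about `x` the kernel cancels the Jacobian `t ^ (n - 1)` exactly. -/
theorem lintegral_mul_rieszKernel (hn : 0 < n) {f : Euc n → ℝ≥0∞} (hf : Measurable f)
    (x : Euc n) :
    ∫⁻ y, f y * rieszKernel x y = ∫⁻ θ, (∫⁻ t in Ioi (0 : ℝ), f (x + t • θ)) ∂sphereMeasure n := by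
  have h1 : ∫⁻ y, f y * rieszKernel x y = ∫⁻ y, f (x + y) * rieszKernel x (x + y) :=
    (lintegral_add_left_eq_self (fun y => f y * rieszKernel x y) x).symm
  rw [h1, lintegral_polar hn (by unfold rieszKernel; fun_prop)]
  refine lintegral_congr_ae ?_
  filter_upwards [ae_sphereMeasure_norm_eq_one] with θ hθ
  refine setLIntegral_congr_fun measurableSet_Ioi fun t (ht : 0 < t) => ?_
  rw [mul_assoc, rieszKernel, ← ENNReal.ofReal_mul (by positivity)]
  have : ‖x - (x + t • θ)‖ = t := by simp [norm_smul, hθ, abs_of_pos ht]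
  rw [this, one_div, inv_mul_cancel₀ (pow_ne_zero _ ht.ne')]
  simp

/-- The volume integral of `|⟪v, y⟫|` over the unit ball is at most its integral over the sphere,
since the radial factor is at most `1`. It is bounded below on a ball of radius `1/4` about `v /
(2‖v‖)`, which lies in the unit ball and on which the inner product is at least `‖v‖ / 4`. -/
theorem norm_smul_le_lintegral_inner (hn : 0 < n) : ∃ c : ℝ, 0 < c ∧ ∀ v : Euc n,
    ENNReal.ofReal (c * ‖v‖) ≤ ∫⁻ θ, ENNReal.ofReal |inner ℝ v θ| ∂sphereMeasure n := by
  have : Nonempty (Fin n) := ⟨⟨0, hn⟩⟩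
  have hpos : 0 < volume.real (ball (0 : Euc n) (1 / 4)) :=
    ENNReal.toReal_pos (measure_ball_pos _ _ (by norm_num)).ne' measure_ball_lt_top.ne
  refine ⟨volume.real (ball (0 : Euc n) (1 / 4)) / 4, by positivity, fun v => ?_⟩
  rcases eq_or_ne v 0 with rfl | hv
  · simp
  have hv' : 0 < ‖v‖ := norm_pos_iff.2 hv
  set e : Euc n := (2 * ‖v‖)⁻¹ • v with he
  have hne : ‖e‖ = 1 / 2 := by
    rw [he, norm_smul, Real.norm_of_nonneg (by positivity)]; field_simp
  have hve : inner ℝ v e = ‖v‖ / 2 := by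
    rw [he, inner_smul_right, real_inner_self_eq_norm_sq]; field_simp
  let f : Euc n → ℝ≥0∞ := (ball (0 : Euc n) 1).indicator fun y => ENNReal.ofReal |inner ℝ v y|
  have hf : Measurable f := Measurable.indicator (by fun_prop) measurableSet_ball
  have hball : ∀ y ∈ ball e (1 / 4), ENNReal.ofReal (‖v‖ / 4) ≤ f y := by
    intro y hy
    rw [mem_ball, dist_eq_norm] at hy
    have h1 : ‖y‖ < 1 := by
      calc ‖y‖ = ‖(y - e) + e‖ := by simp
        _ ≤ ‖y - e‖ + ‖e‖ := norm_add_le _ _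
        _ < 1 := by linarith
    rw [show f y = ENNReal.ofReal |inner ℝ v y| from indicator_of_mem (by simpa using h1) _]
    refine ENNReal.ofReal_le_ofReal (le_trans ?_ (le_abs_self _))
    have h2 : inner ℝ v y = inner ℝ v e + inner ℝ v (y - e) := by rw [← inner_add_right]; simp
    have h3 := abs_real_inner_le_norm v (y - e)
    have h4 := (abs_le.1 h3).1
    have : ‖v‖ * ‖y - e‖ ≤ ‖v‖ * (1 / 4) := by gcongr
    rw [h2, hve]; linarith
  calc ENNReal.ofReal (volume.real (ball (0 : Euc n) (1 / 4)) / 4 * ‖v‖)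
      = ENNReal.ofReal (‖v‖ / 4) * volume (ball e (1 / 4)) := by
        rw [Measure.addHaar_ball_center, ← ofReal_measureReal measure_ball_lt_top.ne,
          ← ENNReal.ofReal_mul (by positivity)]
        congr 1; ring
    _ = ∫⁻ y in ball e (1 / 4), ENNReal.ofReal (‖v‖ / 4) := by simp
    _ ≤ ∫⁻ y in ball e (1 / 4), f y := setLIntegral_mono hf hball
    _ ≤ ∫⁻ y, f y := setLIntegral_le_lintegral _ _
    _ = ∫⁻ θ, (∫⁻ t in Ioi (0 : ℝ), f (t • θ) * ENNReal.ofReal (t ^ (n - 1)))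
          ∂sphereMeasure n :=
        lintegral_polar hn hf
    _ ≤ ∫⁻ θ, ENNReal.ofReal |inner ℝ v θ| ∂sphereMeasure n := by
        refine lintegral_mono_ae ?_
        filter_upwards [ae_sphereMeasure_norm_eq_one] with θ hθ
        calc ∫⁻ t in Ioi (0 : ℝ), f (t • θ) * ENNReal.ofReal (t ^ (n - 1))
            ≤ ∫⁻ t in Ioi (0 : ℝ),
              (Ioo (0 : ℝ) 1).indicator (fun _ => ENNReal.ofReal |inner ℝ v θ|) t := by
              refine setLIntegral_mono' measurableSet_Ioi fun t (ht : 0 < t) => ?_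
              have hnt : ‖t • θ‖ = t := by simp [norm_smul, hθ, abs_of_pos ht]
              by_cases h1 : t < 1
              · rw [show f (t • θ) = _ from indicator_of_mem (by simpa [hnt] using h1) _,
                  indicator_of_mem (show t ∈ Ioo (0 : ℝ) 1 from ⟨ht, h1⟩),
                  ← ENNReal.ofReal_mul (abs_nonneg _), inner_smul_right, abs_mul, abs_of_pos ht]
                refine ENNReal.ofReal_le_ofReal ?_
                have h5 : t * t ^ (n - 1) ≤ 1 := by
                  have := pow_le_one₀ (n := n - 1) ht.le h1.le
                  have h6 : 0 ≤ t ^ (n - 1) := by positivity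
                  nlinarith
                calc t * |inner ℝ v θ| * t ^ (n - 1) = (t * t ^ (n - 1)) * |inner ℝ v θ| := by ring
                  _ ≤ 1 * |inner ℝ v θ| := by gcongr
                  _ = _ := one_mul _
              · rw [show f (t • θ) = 0 from indicator_of_notMem (by simpa [hnt] using h1) _]
                simp
          _ ≤ ∫⁻ t, (Ioo (0 : ℝ) 1).indicator (fun _ => ENNReal.ofReal |inner ℝ v θ|) t :=
              setLIntegral_le_lintegral _ _
          _ = ENNReal.ofReal |inner ℝ v θ| := by
              rw [lintegral_indicator measurableSet_Ioo]; simp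

/-! ### Comparison with the Hausdorff measure -/

/-- The cone over a cap of radius `δ` is a tube of width `δ` about the segment from `0` to `θ₀`. At
most `3 / δ` balls of radius `2 * δ` centred on that segment cover it, and each has volume of order
`δ ^ n`. -/
theorem sphereMeasure_closedBall_le (hn : 0 < n) {θ₀ : Euc n} (hθ₀ : ‖θ₀‖ = 1) {δ : ℝ}
    (hδ : 0 < δ) (hδ2 : δ ≤ 2) :
    sphereMeasure n (closedBall θ₀ δ) ≤
      n * (ENNReal.ofReal (3 * 2 ^ n) * volume (ball (0 : Euc n) 1)) *
        ENNReal.ofReal (δ ^ (n - 1)) := by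
  rw [sphereMeasure, Measure.map_apply measurable_subtype_coe measurableSet_closedBall,
    Measure.toSphere_apply' _ (measurable_subtype_coe measurableSet_closedBall), mul_assoc]
  simp only [finrank_euclideanSpace, Fintype.card_fin]
  gcongr
  set N := ⌊1 / δ⌋₊ + 1
  have hsub : Ioo (0 : ℝ) 1 • ((Subtype.val : sphere (0 : Euc n) 1 → Euc n) ''
      (Subtype.val ⁻¹' closedBall θ₀ δ)) ⊆
      ⋃ k ∈ Finset.range N, closedBall ((k * δ) • θ₀ : Euc n) (2 * δ) := by
    rintro _ ⟨t, ht, _, ⟨θ, hθ, rfl⟩, rfl⟩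
    have hθ' : ‖(θ : Euc n) - θ₀‖ ≤ δ := by rw [← dist_eq_norm]; exact hθ
    simp only [mem_iUnion, mem_closedBall, dist_eq_norm, Finset.mem_range]
    have h1 : (⌊t / δ⌋₊ : ℝ) ≤ t / δ := Nat.floor_le (by have := ht.1; positivity)
    have h2 : t / δ < ⌊t / δ⌋₊ + 1 := Nat.lt_floor_add_one _
    rw [le_div_iff₀ hδ] at h1
    rw [div_lt_iff₀ hδ] at h2
    refine ⟨⌊t / δ⌋₊, Nat.lt_succ_of_le (Nat.floor_le_floor (by gcongr; exact ht.2.le)), ?_⟩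
    have h3 : t • (θ : Euc n) - (⌊t / δ⌋₊ * δ) • θ₀ =
        t • ((θ : Euc n) - θ₀) + (t - ⌊t / δ⌋₊ * δ) • θ₀ := by module
    change ‖t • (θ : Euc n) - (⌊t / δ⌋₊ * δ) • θ₀‖ ≤ _
    rw [h3]
    refine (norm_add_le _ _).trans ?_
    rw [norm_smul, norm_smul, hθ₀, Real.norm_of_nonneg ht.1.le, Real.norm_of_nonneg (by linarith)]
    have : t * ‖(θ : Euc n) - θ₀‖ ≤ 1 * δ := by
      gcongr
      exact ht.2.le
    nlinarith
  -- The bound `δ ≤ 2` absorbs the additional ball in `N`, as `1 ≤ 2 / δ`.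
  have hN : (N : ℝ) ≤ 3 / δ := by
    have h1 : (⌊1 / δ⌋₊ : ℝ) ≤ 1 / δ := Nat.floor_le (by positivity)
    have h2 : 1 ≤ 2 / δ := by rwa [le_div_iff₀ hδ, one_mul]
    have h3 : 3 / δ = 1 / δ + 2 / δ := by ring
    push_cast [N]
    linarith
  calc volume (Ioo (0 : ℝ) 1 • ((Subtype.val : sphere (0 : Euc n) 1 → Euc n) ''
        (Subtype.val ⁻¹' closedBall θ₀ δ)))
      ≤ volume (⋃ k ∈ Finset.range N, closedBall ((k * δ) • θ₀ : Euc n) (2 * δ)) :=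
        measure_mono hsub
    _ ≤ ∑ k ∈ Finset.range N, volume (closedBall ((k * δ) • θ₀ : Euc n) (2 * δ)) :=
        measure_biUnion_finset_le _ _
    _ = N * (ENNReal.ofReal ((2 * δ) ^ n) * volume (ball (0 : Euc n) 1)) := by
        simp [Measure.addHaar_closedBall _ _ (show 0 ≤ 2 * δ by positivity)]
    _ = ENNReal.ofReal (N * (2 * δ) ^ n) * volume (ball (0 : Euc n) 1) := by
        rw [ENNReal.ofReal_mul (by positivity), ENNReal.ofReal_natCast, mul_assoc]
    _ ≤ ENNReal.ofReal (3 * 2 ^ n * δ ^ (n - 1)) * volume (ball (0 : Euc n) 1) := by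
        refine mul_le_mul_left (ENNReal.ofReal_le_ofReal ?_) _
        calc (N : ℝ) * (2 * δ) ^ n ≤ 3 / δ * (2 * δ) ^ n := by gcongr
          _ = 3 * 2 ^ n * δ ^ (n - 1) := by
            obtain ⟨m, rfl⟩ := Nat.exists_eq_succ_of_ne_zero hn.ne'
            rw [mul_pow]; simp only [Nat.succ_eq_add_one, Nat.add_sub_cancel]
            field_simp
            ring
    _ = _ := by rw [ENNReal.ofReal_mul (by positivity)]; ring

/-- Mass distribution principle: a measure that gives every small set at most a constant times its
diameter to the power `n - 1` is dominated by Hausdorff measure (`Measure.le_hausdorffMeasure`). The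
cap estimate provides this bound. -/
theorem exists_sphereMeasure_le_hausdorffMeasure (hn : 2 ≤ n) : ∃ C : ℝ, 0 < C ∧
    sphereMeasure n ≤ ENNReal.ofReal C • (μH[(n : ℝ) - 1] : Measure (Euc n)).restrict
      (sphere 0 1) := by
  have hn0 : 0 < n := by omega
  set K : ℝ≥0∞ := n * (ENNReal.ofReal (3 * 2 ^ n) * volume (ball (0 : Euc n) 1)) with hK
  have hKtop : K ≠ ⊤ := by
    refine ENNReal.mul_ne_top (by simp) (ENNReal.mul_ne_top ENNReal.ofReal_ne_top measure_ball_lt_top.ne)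
  have hK0 : K ≠ 0 := by
    refine mul_ne_zero (by simpa using hn0.ne')
      (mul_ne_zero ?_ (measure_ball_pos _ _ one_pos).ne')
    rw [Ne, ENNReal.ofReal_eq_zero, not_le]
    positivity
  have hsphere : ∀ s, sphereMeasure n s = sphereMeasure n (s ∩ sphere 0 1) := fun s => by
    refine measure_congr ?_
    filter_upwards [ae_sphereMeasure_norm_eq_one] with θ hθ
    refine propext ⟨fun h => ⟨h, by simpa using hθ⟩, fun h => h.1⟩
  have key : ∀ s : Set (Euc n), ediam s ≤ 1 →
      sphereMeasure n s ≤ K * ediam s ^ ((n : ℝ) - 1) := by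
    intro s hs
    rw [hsphere]
    rcases eq_empty_or_nonempty (s ∩ sphere (0 : Euc n) 1) with h0 | ⟨θ₀, hθ₀s, hθ₀⟩
    · simp [h0]
    have hθ₀1 : ‖θ₀‖ = 1 := by simpa using hθ₀
    have hfin : ediam s ≠ ⊤ := (hs.trans_lt ENNReal.one_lt_top).ne
    set d := (ediam s).toReal with hd
    have hd0 : 0 ≤ d := ENNReal.toReal_nonneg
    have hd1 : d ≤ 1 := by
      have := ENNReal.toReal_mono ENNReal.one_ne_top hs
      simpa using this
    -- The diameter may be zero whereas the cap estimate needs a positive radius; hence the `ε`,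
    -- sent to zero afterwards.
    have hb : ∀ ε ∈ Ioo (0 : ℝ) 1, sphereMeasure n (s ∩ sphere 0 1) ≤
        K * ENNReal.ofReal ((d + ε) ^ (n - 1)) := by
      intro ε hε
      refine le_trans (measure_mono ?_) (sphereMeasure_closedBall_le hn0 hθ₀1
        (add_pos_of_nonneg_of_pos hd0 hε.1) (by linarith [hε.2]))
      rintro y ⟨hy, -⟩
      have h1 : edist y θ₀ ≤ ediam s := edist_le_ediam_of_mem hy hθ₀s
      have h2 := ENNReal.toReal_mono hfin h1
      rw [← dist_edist] at h2
      rw [mem_closedBall]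
      linarith [hε.1]
    have hlim : Tendsto (fun ε : ℝ => K * ENNReal.ofReal ((d + ε) ^ (n - 1))) (𝓝[>] 0)
        (𝓝 (K * ENNReal.ofReal ((d + 0) ^ (n - 1)))) := by
      refine ENNReal.Tendsto.const_mul ?_ (Or.inr hKtop)
      refine (ENNReal.tendsto_ofReal ?_)
      exact ((by fun_prop : Continuous fun ε : ℝ => (d + ε) ^ (n - 1)).tendsto 0).mono_left
        nhdsWithin_le_nhds
    have hle := ge_of_tendsto hlim (by
      filter_upwards [Ioo_mem_nhdsGT (zero_lt_one (α := ℝ))] with ε hε using hb ε hε)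
    refine hle.trans (le_of_eq ?_)
    rw [add_zero, ENNReal.ofReal_pow hd0, hd, ENNReal.ofReal_toReal hfin, ← ENNReal.rpow_natCast,
      Nat.cast_sub (by omega)]
    simp
  have hle : K⁻¹ • sphereMeasure n ≤ μH[(n : ℝ) - 1] := by
    refine Measure.le_hausdorffMeasure _ _ 1 one_pos fun s hs => ?_
    rw [Measure.smul_apply, smul_eq_mul, mul_comm, ← div_eq_mul_inv]
    exact ENNReal.div_le_of_le_mul' (key s hs)
  refine ⟨K.toReal, ENNReal.toReal_pos hK0 hKtop, ?_⟩
  rw [ENNReal.ofReal_toReal hKtop]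
  refine Measure.le_iff.2 fun s hs => ?_
  rw [hsphere, Measure.smul_apply, Measure.restrict_apply hs, smul_eq_mul]
  have := hle (s ∩ sphere 0 1)
  rw [Measure.smul_apply, smul_eq_mul, mul_comm, ← div_eq_mul_inv,
    ENNReal.div_le_iff hK0 hKtop, mul_comm] at this
  exact this

theorem sphereMeasure_null_of_hausdorffMeasure_null (hn : 2 ≤ n) {N : Set (Euc n)}
    (hN : μH[(n : ℝ) - 1] N = 0) : sphereMeasure n N = 0 := by
  obtain ⟨C, -, hC⟩ := exists_sphereMeasure_le_hausdorffMeasure hn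
  refine le_antisymm ((hC N).trans ?_) (zero_le)
  rw [Measure.smul_apply, smul_eq_mul, Measure.absolutelyContinuous_of_le Measure.restrict_le_self hN, mul_zero]

/-- Radial projection from a point at positive distance does not charge null sets. -/
theorem ae_add_smul_notMem_of_hausdorffMeasure_null (hn : 2 ≤ n) {N : Set (Euc n)}
    (hN : μH[(n : ℝ) - 1] N = 0) {x : Euc n} {r : ℝ} (hr : 0 < r)
    (hxr : ∀ y ∈ N, r ≤ ‖y - x‖) :
    ∀ᵐ θ ∂sphereMeasure n, ∀ t : ℝ, 0 < t → x + t • θ ∉ N := by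
  let P : Euc n → Euc n := fun y => (‖y - x‖)⁻¹ • (y - x)
  -- At distance at least `r` from its centre the radial projection is Lipschitz, so it maps a
  -- Hausdorff null set to a null set of directions.
  have hlip : LipschitzOnWith (Real.toNNReal (2 / r)) P N := by
    refine LipschitzOnWith.of_dist_le_mul fun y hy z hz => ?_
    rw [Real.coe_toNNReal _ (by positivity), dist_eq_norm, dist_eq_norm]
    have hy0 : 0 < ‖y - x‖ := hr.trans_le (hxr y hy)
    have hz0 : 0 < ‖z - x‖ := hr.trans_le (hxr z hz)
    have h1 : P y - P z = (‖y - x‖)⁻¹ • ((y - z) +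
        ((‖z - x‖ - ‖y - x‖) * (‖z - x‖)⁻¹) • (z - x)) := by
      simp only [P]
      have : (‖z - x‖)⁻¹ = (‖y - x‖)⁻¹ - (‖y - x‖)⁻¹ * ((‖z - x‖ - ‖y - x‖) * (‖z - x‖)⁻¹) := by
        field_simp; ring
      conv_lhs => rw [this]
      module
    have h2 : ‖((‖z - x‖ - ‖y - x‖) * (‖z - x‖)⁻¹) • (z - x)‖ ≤ ‖y - z‖ := by
      rw [norm_smul, norm_mul, norm_inv, norm_norm, mul_assoc, inv_mul_cancel₀ hz0.ne', mul_one,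
        norm_sub_rev y z]
      have := abs_norm_sub_norm_le (z - x) (y - x)
      simpa using this
    rw [h1, norm_smul, norm_inv, norm_norm]
    calc (‖y - x‖)⁻¹ * _ ≤ r⁻¹ * (‖y - z‖ + ‖y - z‖) := by
          gcongr
          · exact hxr y hy
          · exact (norm_add_le _ _).trans (by gcongr)
      _ = _ := by ring
  have h0 : μH[(n : ℝ) - 1] (P '' N) = 0 := by
    have h1 : (1 : ℝ) ≤ n := by exact_mod_cast (by omega : 1 ≤ n)
    refine le_antisymm ((hlip.hausdorffMeasure_image_le (sub_nonneg.2 h1)).trans ?_) (zero_le)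
    rw [hN, mul_zero]
  have h3 := sphereMeasure_null_of_hausdorffMeasure_null hn h0
  have h4 : ∀ᵐ θ ∂sphereMeasure n, θ ∉ P '' N := measure_eq_zero_iff_ae_notMem.1 h3
  filter_upwards [h4, ae_sphereMeasure_norm_eq_one] with θ hθ hθ1 t ht hmem
  refine hθ ⟨_, hmem, ?_⟩
  simp [P, norm_smul, hθ1, abs_of_pos ht, smul_smul, inv_mul_cancel₀ ht.ne']

/-! ### Mollification -/

open scoped Convolution in
/-- Convolution with a normalized bump function. -/
noncomputable def mollify (φ : ContDiffBump (0 : Euc n)) (f : Euc n → ℝ) : Euc n → ℝ :=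
  φ.normed volume ⋆[ContinuousLinearMap.lsmul ℝ ℝ, volume] f

theorem mollify_apply (φ : ContDiffBump (0 : Euc n)) (f : Euc n → ℝ) (x : Euc n) :
    mollify φ f x = ∫ t, φ.normed volume t * f (x - t) := rfl

theorem mollify_apply_swap (φ : ContDiffBump (0 : Euc n)) (f : Euc n → ℝ) (x : Euc n) :
    mollify φ f x = ∫ t, φ.normed volume (x - t) * f t :=
  convolution_lsmul_swap

theorem contDiff_mollify (φ : ContDiffBump (0 : Euc n)) {f : Euc n → ℝ}
    (hf : LocallyIntegrable f) : ContDiff ℝ ∞ (mollify φ f) :=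
  φ.hasCompactSupport_normed.contDiff_convolution_left _ φ.contDiff_normed hf

theorem mollify_sub (φ : ContDiffBump (0 : Euc n)) {f g : Euc n → ℝ}
    (hf : LocallyIntegrable f) (hg : LocallyIntegrable g) (x : Euc n) :
    mollify φ (f - g) x = mollify φ f x - mollify φ g x := by
  have h1 := (φ.hasCompactSupport_normed (μ := volume)).convolutionExists_left
    (ContinuousLinearMap.lsmul ℝ ℝ) φ.continuous_normed hf x (μ := volume)
  have h2 := (φ.hasCompactSupport_normed (μ := volume)).convolutionExists_left
    (ContinuousLinearMap.lsmul ℝ ℝ) φ.continuous_normed hg x (μ := volume)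
  refine Eq.trans ?_ (integral_sub h1 h2)
  simp [mollify_apply, mul_sub]

theorem lintegral_enorm_mollify_le (φ : ContDiffBump (0 : Euc n)) {f : Euc n → ℝ}
    (hf : Integrable f) : ∫⁻ x, ‖mollify φ f x‖ₑ ≤ ∫⁻ x, ‖f x‖ₑ := by
  have hm : AEMeasurable (fun p : Euc n × Euc n => ‖φ.normed volume p.2 * f (p.1 - p.2)‖ₑ)
      (volume.prod volume) :=
    ((φ.integrable_normed (μ := volume)).convolution_integrand
      (ContinuousLinearMap.lsmul ℝ ℝ) hf).aestronglyMeasurable.enorm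
  have h1 : ∫⁻ t, ‖φ.normed volume t‖ₑ = 1 := by
    rw [← ofReal_integral_norm_eq_lintegral_enorm φ.integrable_normed]
    simp_rw [Real.norm_of_nonneg (φ.nonneg_normed _)]
    rw [φ.integral_normed, ENNReal.ofReal_one]
  calc ∫⁻ x, ‖mollify φ f x‖ₑ
      ≤ ∫⁻ x, ∫⁻ t, ‖φ.normed volume t * f (x - t)‖ₑ := by
        refine lintegral_mono fun x => ?_
        rw [mollify_apply]
        exact enorm_integral_le_lintegral_enorm _
    _ = ∫⁻ t, ∫⁻ x, ‖φ.normed volume t * f (x - t)‖ₑ := lintegral_lintegral_swap hm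
    _ = ∫⁻ t, ‖φ.normed volume t‖ₑ * ∫⁻ x, ‖f x‖ₑ := by
        refine lintegral_congr fun t => ?_
        simp_rw [enorm_mul]
        rw [lintegral_const_mul' _ _ enorm_ne_top,
          lintegral_sub_right_eq_self (fun x => ‖f x‖ₑ) t]
    _ = ∫⁻ x, ‖f x‖ₑ := by
        rw [lintegral_mul_const'' _ φ.continuous_normed.enorm.aemeasurable, h1, one_mul]

/-- Approximation by a continuous compactly supported `g`, with the contraction property of
mollification for `f - g`. The threshold `δ` serves every bump of outer radius at most `δ`, which
permits one mollifier for several functions. -/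
theorem exists_lintegral_mollify_sub_le {f : Euc n → ℝ} (hf : Integrable f) {ε : ℝ≥0∞}
    (hε : ε ≠ 0) : ∃ δ : ℝ, 0 < δ ∧ ∀ φ : ContDiffBump (0 : Euc n), φ.rOut ≤ δ →
      ∫⁻ x, ‖mollify φ f x - f x‖ₑ ≤ ε := by
  have hε3 : ε / 3 ≠ 0 := by simp [hε]
  obtain ⟨g, hgc, hfg, hg, hgi⟩ := hf.exists_hasCompactSupport_lintegral_sub_le hε3
  have hK : IsCompact (cthickening 1 (tsupport g)) := hgc.cthickening
  obtain ⟨η, hη, hηε⟩ : ∃ η : ℝ, 0 < η ∧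
      ENNReal.ofReal η * volume (cthickening 1 (tsupport g)) ≤ ε / 3 := by
    have hlim : Tendsto (fun η : ℝ => ENNReal.ofReal η * volume (cthickening 1 (tsupport g)))
        (𝓝[>] 0) (𝓝 (ENNReal.ofReal 0 * volume (cthickening 1 (tsupport g)))) :=
      ENNReal.Tendsto.mul_const
        ((ENNReal.continuous_ofReal.tendsto 0).mono_left nhdsWithin_le_nhds)
        (Or.inr hK.measure_lt_top.ne)
    rw [ENNReal.ofReal_zero, zero_mul] at hlim
    have h1 := hlim.eventually (Iic_mem_nhds (pos_iff_ne_zero.2 hε3))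
    obtain ⟨η, h2, h3⟩ := (h1.and self_mem_nhdsWithin).exists
    exact ⟨η, h3, h2⟩
  obtain ⟨δ, hδ, hgδ⟩ := Metric.uniformContinuous_iff.1
    (hgc.uniformContinuous_of_continuous hg) η hη
  -- The bound `1` keeps `mollify φ g - g` supported in the `1`-thickening, where the uniform error
  -- `η` integrates to at most `ε / 3`.
  refine ⟨min (δ / 2) 1, by positivity, fun φ hφ => ?_⟩
  have hg1 : ∀ x, ‖mollify φ g x - g x‖ₑ ≤
      (cthickening 1 (tsupport g)).indicator (fun _ => ENNReal.ofReal η) x := by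
    intro x
    by_cases hx : x ∈ cthickening 1 (tsupport g)
    · rw [indicator_of_mem hx, ← ofReal_norm, ← dist_eq_norm]
      refine ENNReal.ofReal_le_ofReal (φ.dist_normed_convolution_le hg.aestronglyMeasurable ?_)
      intro y hy
      refine (hgδ ?_).le
      have : dist y x < φ.rOut := hy
      have := hφ.trans (min_le_left _ _)
      linarith
    · rw [indicator_of_notMem hx]
      have h0 : ∀ y ∈ ball x φ.rOut, g y = 0 := by
        intro y hy
        by_contra hne
        refine hx (mem_cthickening_of_dist_le x y 1 _ (subset_tsupport g hne) ?_)
        rw [dist_comm]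
        exact (mem_ball.1 hy).le.trans (hφ.trans (min_le_right _ _))
      have hx0 := h0 x (mem_ball_self φ.rOut_pos)
      have : mollify φ g x = g x := φ.normed_convolution_eq_right fun y hy => by rw [h0 y hy, hx0]
      simp [this]
  have hsplit : ∀ x, ‖mollify φ f x - f x‖ₑ ≤
      ‖mollify φ (f - g) x‖ₑ + (‖mollify φ g x - g x‖ₑ + ‖f x - g x‖ₑ) := by
    intro x
    have : mollify φ f x - f x =
        mollify φ (f - g) x + ((mollify φ g x - g x) - (f x - g x)) := by
      rw [mollify_sub φ hf.locallyIntegrable hgi.locallyIntegrable]; ring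
    rw [this]
    exact (enorm_add_le _ _).trans (by gcongr; exact enorm_sub_le)
  have hm1 : Measurable fun x => ‖mollify φ (f - g) x‖ₑ :=
    (contDiff_mollify φ (hf.sub hgi).locallyIntegrable).continuous.enorm.measurable
  have hm2 : Measurable fun x => ‖mollify φ g x - g x‖ₑ :=
    ((contDiff_mollify φ hgi.locallyIntegrable).continuous.sub hg).enorm.measurable
  calc ∫⁻ x, ‖mollify φ f x - f x‖ₑ
      ≤ ∫⁻ x, (‖mollify φ (f - g) x‖ₑ + (‖mollify φ g x - g x‖ₑ + ‖f x - g x‖ₑ)) :=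
        lintegral_mono hsplit
    _ = (∫⁻ x, ‖mollify φ (f - g) x‖ₑ) + ((∫⁻ x, ‖mollify φ g x - g x‖ₑ) +
        ∫⁻ x, ‖f x - g x‖ₑ) := by
        rw [lintegral_add_left hm1, lintegral_add_left hm2]
    _ ≤ ε / 3 + (ε / 3 + ε / 3) := by
        gcongr
        · exact (lintegral_enorm_mollify_le φ (hf.sub hgi)).trans hfg
        · refine (lintegral_mono hg1).trans ?_
          rw [lintegral_indicator isClosed_cthickening.measurableSet]
          simpa using hηε
    _ = ε := by rw [← add_assoc, ENNReal.add_thirds]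

/-- Simultaneous fast mollification of finitely many integrable functions. -/
theorem exists_fast_mollifiers {ι : Type*} [Fintype ι] {f : ι → Euc n → ℝ}
    (hf : ∀ k, Integrable (f k)) : ∃ φ : ℕ → ContDiffBump (0 : Euc n),
      Tendsto (fun j => (φ j).rOut) atTop (𝓝 0) ∧
      ∀ k, ∑' j, ∫⁻ x, ‖mollify (φ j) (f k) x - f k x‖ₑ ≠ ⊤ := by
  have h : ∀ j : ℕ, ∃ φ : ContDiffBump (0 : Euc n), φ.rOut ≤ 1 / ((j : ℝ) + 1) ∧
      ∀ k, ∫⁻ x, ‖mollify φ (f k) x - f k x‖ₑ ≤ (1 / 2 : ℝ≥0∞) ^ j := by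
    intro j
    have hj : (1 / 2 : ℝ≥0∞) ^ j ≠ 0 := pow_ne_zero _ (by simp)
    choose δ hδ hδf using fun k => exists_lintegral_mollify_sub_le (hf k) hj
    obtain ⟨r, hr, hrδ⟩ : ∃ r : ℝ, 0 < r ∧ ∀ k, r ≤ δ k := by
      cases isEmpty_or_nonempty ι
      · exact ⟨1, one_pos, fun k => isEmptyElim k⟩
      · obtain ⟨k₀, hk₀⟩ := Finite.exists_min δ
        exact ⟨δ k₀, hδ k₀, hk₀⟩
    have hr' : 0 < min r (1 / ((j : ℝ) + 1)) := by positivity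
    exact ⟨⟨min r (1 / ((j : ℝ) + 1)) / 2, min r (1 / ((j : ℝ) + 1)), by positivity,
      by linarith⟩, min_le_right _ _, fun k => hδf k _ ((min_le_left _ _).trans (hrδ k))⟩
  choose φ hφ1 hφ2 using h
  refine ⟨φ, squeeze_zero (fun j => (φ j).rOut_pos.le) hφ1
    tendsto_one_div_add_atTop_nhds_zero_nat, fun k => ?_⟩
  refine ne_top_of_le_ne_top ?_ (ENNReal.tsum_le_tsum fun j => hφ2 j k)
  rw [ENNReal.tsum_geometric]
  simp

/-- `W` is the weak `i`-th partial derivative of `w` on the whole space, both being integrable. -/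
def HasIntegrableWeakPartial (w W : Euc n → ℝ) (i : Fin n) : Prop :=
  Integrable w ∧ Integrable W ∧ ∀ φ : Euc n → ℝ, ContDiff ℝ ∞ φ → HasCompactSupport φ →
    ∫ x, w x * fderiv ℝ φ x (EuclideanSpace.single i 1) = - ∫ x, W x * φ x

/-- The derivative falls on the bump, and the reflected bump `t ↦ ψ (x - t)` is an admissible test
function. The sign from the reflection cancels the one in the definition of the weak derivative. -/
theorem fderiv_mollify {w W : Euc n → ℝ} {i : Fin n} (h : HasIntegrableWeakPartial w W i)
    (φ : ContDiffBump (0 : Euc n)) (x : Euc n) :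
    fderiv ℝ (mollify φ w) x (EuclideanSpace.single i 1) = mollify φ W x := by
  set ψ := φ.normed (volume : Measure (Euc n)) with hψ
  have hψc : ContDiff ℝ ∞ ψ := φ.contDiff_normed
  have hψs : HasCompactSupport ψ := φ.hasCompactSupport_normed
  have hψ1 : ContDiff ℝ 1 ψ := φ.contDiff_normed
  have h1 := hψs.hasFDerivAt_convolution_left (ContinuousLinearMap.lsmul ℝ ℝ) hψ1
    h.1.locallyIntegrable x (μ := volume)
  have hex := (hψs.fderiv ℝ).convolutionExists_left
    ((ContinuousLinearMap.lsmul ℝ ℝ).precompL (Euc n)) (hψ1.continuous_fderiv one_ne_zero)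
    h.1.locallyIntegrable x (μ := volume)
  have h2 : fderiv ℝ (mollify φ w) x (EuclideanSpace.single i 1) =
      ∫ t, fderiv ℝ ψ (x - t) (EuclideanSpace.single i 1) * w t := by
    rw [show fderiv ℝ (mollify φ w) x = _ from HasFDerivAt.fderiv h1, convolution_eq_swap]
    have hex' := hex.integrable_swap
    rw [ContinuousLinearMap.integral_apply hex']
    rfl
  have hφ' : ContDiff ℝ ∞ fun t => ψ (x - t) := hψc.comp (contDiff_const.sub contDiff_id)
  have hφs : HasCompactSupport fun t => ψ (x - t) :=
    hψs.comp_homeomorph (Homeomorph.subLeft x)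
  have h3 := h.2.2 _ hφ' hφs
  have h4 : ∀ t, fderiv ℝ (fun t => ψ (x - t)) t (EuclideanSpace.single i 1) =
      - fderiv ℝ ψ (x - t) (EuclideanSpace.single i 1) := by
    intro t
    have h5 : HasFDerivAt (fun t => x - t) (-ContinuousLinearMap.id ℝ (Euc n)) t :=
      (hasFDerivAt_id t).const_sub x
    have h6 := ((hψc.differentiable (by simp)) (x - t)).hasFDerivAt.comp t h5
    have h7 : fderiv ℝ (fun t => ψ (x - t)) t =
        (fderiv ℝ ψ (x - t)).comp (-ContinuousLinearMap.id ℝ (Euc n)) := h6.fderiv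
    rw [h7]; simp
  simp_rw [h4, mul_neg] at h3
  rw [integral_neg, neg_inj] at h3
  rw [h2, mollify_apply_swap]
  simp_rw [mul_comm _ (w _), mul_comm _ (W _)]
  exact h3

/-! ### Potentials and convergence along rays -/

theorem lintegral_ball_rieszKernel (hn : 0 < n) (x : Euc n) {r : ℝ} :
    ∫⁻ y in ball x r, rieszKernel x y = ENNReal.ofReal r * sphereMeasure n univ := by
  have h := lintegral_mul_rieszKernel hn
    (f := (ball x r).indicator fun _ => 1) (measurable_const.indicator measurableSet_ball) x
  have h1 : ∫⁻ y in ball x r, rieszKernel x y =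
      ∫⁻ y, (ball x r).indicator (fun _ => 1) y * rieszKernel x y := by
    rw [← lintegral_indicator measurableSet_ball]
    refine lintegral_congr fun y => ?_
    by_cases hy : y ∈ ball x r <;> simp [hy]
  rw [h1, h, ← lintegral_const]
  refine lintegral_congr_ae ?_
  filter_upwards [ae_sphereMeasure_norm_eq_one] with θ hθ
  have h2 : ∫⁻ t in Ioi (0 : ℝ), (ball x r).indicator (fun _ => (1 : ℝ≥0∞)) (x + t • θ) =
      ∫⁻ t in Ioi (0 : ℝ), (Iio r).indicator (fun _ => (1 : ℝ≥0∞)) t := by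
    refine setLIntegral_congr_fun measurableSet_Ioi fun t (ht : 0 < t) => ?_
    have : x + t • θ ∈ ball x r ↔ t ∈ Iio r := by
      simp [norm_smul, hθ, abs_of_pos ht]
    by_cases h : t ∈ Iio r
    · simp only [indicator_of_mem h, indicator_of_mem (this.2 h)]
    · simp only [indicator_of_notMem h, indicator_of_notMem (fun h' => h (this.1 h'))]
  rw [h2, lintegral_indicator measurableSet_Iio, Measure.restrict_restrict measurableSet_Iio,
    Set.inter_comm, Ioi_inter_Iio]
  simp

theorem rieszKernel_le_of_le {x y : Euc n} {a : ℝ} (ha : 0 < a) (h : a ≤ ‖x - y‖) :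
    rieszKernel x y ≤ ENNReal.ofReal (1 / a ^ (n - 1)) := by
  refine ENNReal.ofReal_le_ofReal ?_
  gcongr

/-- The integral of the kernel in `x` over a fixed ball is bounded uniformly in `y`: within distance
`1` of `y` by polar coordinates, elsewhere because the kernel is at most `1`. Tonelli then makes the
potential integrable on every ball. -/
theorem ae_lintegral_mul_rieszKernel_ne_top (hn : 0 < n) {S : Euc n → ℝ≥0∞} (hS : Measurable S)
    (hfin : ∫⁻ y, S y ≠ ⊤) : ∀ᵐ x, ∫⁻ y, S y * rieszKernel x y ≠ ⊤ := by
  have hmeas : Measurable fun p : Euc n × Euc n => S p.2 * rieszKernel p.1 p.2 := by fun_prop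
  have key : ∀ N : ℕ, ∀ᵐ x, x ∈ ball (0 : Euc n) N → ∫⁻ y, S y * rieszKernel x y ≠ ⊤ := by
    intro N
    rw [← ae_restrict_iff' measurableSet_ball]
    have hb : ∀ y, ∫⁻ x in ball (0 : Euc n) N, rieszKernel x y ≤
        sphereMeasure n univ + volume (ball (0 : Euc n) N) := by
      intro y
      calc ∫⁻ x in ball (0 : Euc n) N, rieszKernel x y
          ≤ ∫⁻ x in ball (0 : Euc n) N,
              ((ball y 1).indicator (fun x => rieszKernel y x) x + 1) := by
            refine lintegral_mono fun x => ?_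
            rw [rieszKernel_comm]
            by_cases hx : x ∈ ball y 1
            · rw [indicator_of_mem hx]; exact le_self_add
            · rw [indicator_of_notMem hx, zero_add]
              refine (rieszKernel_le_of_le one_pos ?_).trans (by simp)
              rw [mem_ball, not_lt, dist_comm, dist_eq_norm] at hx
              exact hx
        _ = (∫⁻ x in ball (0 : Euc n) N, (ball y 1).indicator (fun x => rieszKernel y x) x) +
              volume (ball (0 : Euc n) N) := by
            rw [lintegral_add_right _ measurable_const]; simp
        _ ≤ (∫⁻ x, (ball y 1).indicator (fun x => rieszKernel y x) x) +
              volume (ball (0 : Euc n) N) := by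
            gcongr; exact Measure.restrict_le_self
        _ = _ := by
            rw [lintegral_indicator measurableSet_ball, lintegral_ball_rieszKernel hn]; simp
    have h1 : ∫⁻ x in ball (0 : Euc n) N, ∫⁻ y, S y * rieszKernel x y ≠ ⊤ := by
      rw [lintegral_lintegral_swap hmeas.aemeasurable]
      refine ne_top_of_le_ne_top
        (b := ∫⁻ y, S y * (sphereMeasure n univ + volume (ball (0 : Euc n) N))) ?_
        (lintegral_mono fun y => ?_)
      · rw [lintegral_mul_const _ hS]
        exact ENNReal.mul_ne_top hfin (ENNReal.add_ne_top.2
          ⟨measure_ne_top _ _, measure_ball_lt_top.ne⟩)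
      · rw [lintegral_const_mul _ (by unfold rieszKernel; fun_prop)]
        gcongr
        exact hb y
    refine (ae_lt_top' ?_ h1).mono fun x hx => hx.ne
    exact (Measurable.lintegral_prod_right' hmeas).aemeasurable
  filter_upwards [ae_all_iff.2 key] with x hx
  obtain ⟨N, hN⟩ := exists_nat_gt ‖x‖
  exact hx N (by simpa using hN)

theorem Measurable.comp_ray {α : Type*} [MeasurableSpace α] {f : Euc n → α}
    (hf : Measurable f) (x θ : Euc n) : Measurable fun t : ℝ => f (x + t • θ) :=
  hf.comp (by fun_prop)

/-- The sum of the `F j` is integrable, so its Riesz potential is finite at almost every `x`. By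
polar coordinates the series of ray integrals then converges in almost every direction, and its
terms tend to zero. -/
theorem ae_tendsto_lintegral_ray (hn : 0 < n) {F : ℕ → Euc n → ℝ≥0∞}
    (hF : ∀ j, Measurable (F j)) (hfin : ∑' j, ∫⁻ x, F j x ≠ ⊤) :
    ∀ᵐ x : Euc n, ∀ᵐ θ ∂sphereMeasure n,
      Tendsto (fun j => ∫⁻ t in Ioi (0 : ℝ), F j (x + t • θ)) atTop (𝓝 0) := by
  have hS : Measurable fun y => ∑' j, F j y := Measurable.tsum hF
  rw [← lintegral_tsum fun j => (hF j).aemeasurable] at hfin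
  filter_upwards [ae_lintegral_mul_rieszKernel_ne_top hn hS hfin] with x hx
  rw [lintegral_mul_rieszKernel hn hS] at hx
  have hm : Measurable fun p : Euc n × ℝ => ∑' j, F j (x + p.2 • p.1) := hS.comp (by fun_prop)
  filter_upwards [ae_lt_top' (Measurable.lintegral_prod_right' hm).aemeasurable hx] with θ hθ
  rw [lintegral_tsum fun j => ((hF j).comp_ray x θ).aemeasurable] at hθ
  exact ENNReal.tendsto_atTop_zero_of_tsum_ne_top hθ.ne

/-- Away from `x` the kernel is bounded, so no exceptional `x` arises once an initial piece of the
ray is removed. The lengths `1 / (k + 1)` suffice, which keeps the exceptional set of directions a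
countable union. -/
theorem ae_tendsto_lintegral_ray_of_pos (hn : 0 < n) {F : ℕ → Euc n → ℝ≥0∞}
    (hF : ∀ j, Measurable (F j)) (hfin : ∑' j, ∫⁻ x, F j x ≠ ⊤) (x : Euc n) :
    ∀ᵐ θ ∂sphereMeasure n, ∀ a : ℝ, 0 < a →
      Tendsto (fun j => ∫⁻ t in Ioi a, F j (x + t • θ)) atTop (𝓝 0) := by
  have hS : Measurable fun y => ∑' j, F j y := Measurable.tsum hF
  rw [← lintegral_tsum fun j => (hF j).aemeasurable] at hfin
  have key : ∀ k : ℕ, ∀ᵐ θ ∂sphereMeasure n,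
      Tendsto (fun j => ∫⁻ t in Ioi (1 / ((k : ℝ) + 1)), F j (x + t • θ)) atTop (𝓝 0) := by
    intro k
    set a : ℝ := 1 / ((k : ℝ) + 1) with ha
    have ha0 : 0 < a := by positivity
    have hcl : MeasurableSet {y : Euc n | a < ‖y - x‖} :=
      measurableSet_lt measurable_const (by fun_prop)
    have hS' : Measurable ({y : Euc n | a < ‖y - x‖}.indicator fun y => ∑' j, F j y) :=
      hS.indicator hcl
    have h1 : ∫⁻ y, {y : Euc n | a < ‖y - x‖}.indicator (fun y => ∑' j, F j y) y *
        rieszKernel x y ≠ ⊤ := by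
      refine ne_top_of_le_ne_top
        (b := ∫⁻ y, (∑' j, F j y) * ENNReal.ofReal (1 / a ^ (n - 1))) ?_
        (lintegral_mono fun y => ?_)
      · rw [lintegral_mul_const _ hS]
        exact ENNReal.mul_ne_top hfin ENNReal.ofReal_ne_top
      · by_cases hy : a < ‖y - x‖
        · rw [indicator_of_mem (show y ∈ {y : Euc n | a < ‖y - x‖} from hy)]
          gcongr
          exact rieszKernel_le_of_le ha0 (by rw [norm_sub_rev]; exact hy.le)
        · rw [indicator_of_notMem (show y ∉ {y : Euc n | a < ‖y - x‖} from hy), zero_mul]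
          exact zero_le
    rw [lintegral_mul_rieszKernel hn hS'] at h1
    have hm : Measurable fun p : Euc n × ℝ =>
        {y : Euc n | a < ‖y - x‖}.indicator (fun y => ∑' j, F j y) (x + p.2 • p.1) :=
      hS'.comp (by fun_prop)
    filter_upwards [ae_lt_top' (Measurable.lintegral_prod_right' hm).aemeasurable h1,
      ae_sphereMeasure_norm_eq_one] with θ hθ hθ1
    have h2 : ∫⁻ t in Ioi a, ∑' j, F j (x + t • θ) ≤ ∫⁻ t in Ioi (0 : ℝ),
        {y : Euc n | a < ‖y - x‖}.indicator (fun y => ∑' j, F j y) (x + t • θ) := by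
      calc ∫⁻ t in Ioi a, ∑' j, F j (x + t • θ)
          = ∫⁻ t in Ioi a,
            {y : Euc n | a < ‖y - x‖}.indicator (fun y => ∑' j, F j y) (x + t • θ) := by
            refine setLIntegral_congr_fun measurableSet_Ioi fun t (ht : a < t) => ?_
            have : x + t • θ ∈ {y : Euc n | a < ‖y - x‖} := by
              simp [norm_smul, hθ1, abs_of_pos (ha0.trans ht), ht]
            simp only [indicator_of_mem this]
        _ ≤ _ := lintegral_mono_set (Ioi_subset_Ioi ha0.le)
    have h3 := h2.trans_lt hθ
    rw [lintegral_tsum fun j => ((hF j).comp_ray x θ).aemeasurable] at h3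
    exact ENNReal.tendsto_atTop_zero_of_tsum_ne_top h3.ne
  filter_upwards [ae_all_iff.2 key] with θ hθ a ha
  obtain ⟨k, hk⟩ := exists_nat_one_div_lt ha
  exact tendsto_of_tendsto_of_tendsto_of_le_of_le tendsto_const_nhds (hθ k)
    (fun _ => zero_le) fun j => lintegral_mono_set (Ioi_subset_Ioi hk.le)

/-! ### Localization of weak derivatives -/

/-- The classical `i`-th partial derivative. -/
noncomputable def classicalPartial (φ : Euc n → ℝ) (i : Fin n) (x : Euc n) : ℝ :=
  fderiv ℝ φ x (EuclideanSpace.single i 1)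

theorem contDiff_classicalPartial {φ : Euc n → ℝ} (h : ContDiff ℝ ∞ φ) (i : Fin n) :
    ContDiff ℝ ∞ (classicalPartial φ i) :=
  (h.fderiv_right (m := ∞) (by simp)).clm_apply contDiff_const

theorem tsupport_classicalPartial_subset (φ : Euc n → ℝ) (i : Fin n) :
    tsupport (classicalPartial φ i) ⊆ tsupport φ := by
  refine (closure_mono fun x hx => ?_).trans (tsupport_fderiv_subset ℝ (f := φ))
  intro h0
  exact hx (by simp [classicalPartial, h0])

theorem hasCompactSupport_classicalPartial {φ : Euc n → ℝ} (h : HasCompactSupport φ) (i : Fin n) :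
    HasCompactSupport (classicalPartial φ i) :=
  h.of_isClosed_subset (isClosed_tsupport _) (tsupport_classicalPartial_subset φ i)

theorem classicalPartial_mul {φ ψ : Euc n → ℝ} (hφ : ContDiff ℝ ∞ φ) (hψ : ContDiff ℝ ∞ ψ)
    (i : Fin n) (x : Euc n) : classicalPartial (fun y => φ y * ψ y) i x =
      φ x * classicalPartial ψ i x + ψ x * classicalPartial φ i x := by
  have h1 := (hφ.differentiable (by simp)) x
  have h2 := (hψ.differentiable (by simp)) x
  rw [classicalPartial, fderiv_fun_mul h1 h2]
  simp [classicalPartial]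

theorem exists_cutoff {K Ω : Set (Euc n)} (hK : IsCompact K) (hΩ : IsOpen Ω) (hKΩ : K ⊆ Ω) :
    ∃ χ : Euc n → ℝ, ContDiff ℝ ∞ χ ∧ HasCompactSupport χ ∧ tsupport χ ⊆ Ω ∧
      ∀ y ∈ K, χ =ᶠ[𝓝 y] fun _ => 1 := by
  obtain ⟨L, hL, hKL, hLΩ⟩ := exists_compact_between hK hΩ hKΩ
  obtain ⟨f, hf1, hf0, -⟩ := exists_contMDiffMap_one_nhds_of_subset_interior (n := (⊤ : ℕ∞))
    (modelWithCornersSelf ℝ (Euc n)) hK.isClosed hKL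
  have hsub : tsupport f ⊆ L := closure_minimal
    (fun x hx => by_contra fun hxL => hx (hf0 x hxL)) hL.isClosed
  refine ⟨f, f.contMDiff.contDiff, hL.of_isClosed_subset (isClosed_tsupport _) hsub,
    hsub.trans hLΩ, fun y hy => ?_⟩
  exact (eventually_nhdsSet_iff_forall.1 hf1) y hy

theorem integrable_mul_of_tsupport_subset {Ω : Set (Euc n)} {ψ u : Euc n → ℝ}
    (hψ : Continuous ψ) (hψs : HasCompactSupport ψ) (hψΩ : tsupport ψ ⊆ Ω)
    (hu : LocallyIntegrableOn u Ω) : Integrable fun x => ψ x * u x := by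
  have h1 : IntegrableOn u (tsupport ψ) := hu.integrableOn_compact_subset hψΩ hψs
  have h2 : IntegrableOn (fun x => ψ x * u x) (tsupport ψ) :=
    h1.continuousOn_mul hψ.continuousOn hψs
  refine (integrableOn_iff_integrable_of_support_subset ?_).1 h2
  intro x hx
  exact subset_tsupport ψ (left_ne_zero_of_mul hx)

/-- Leibniz rule: if `φ` is a test function on the whole space, then `χ * φ` is one in `Ω`. -/
theorem IsWeakPartial.cutoff_mul {Ω : Set (Euc n)} {u v χ : Euc n → ℝ} {i : Fin n}
    (h : IsWeakPartial Ω u v i) (hχ : ContDiff ℝ ∞ χ) (hχs : HasCompactSupport χ)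
    (hχΩ : tsupport χ ⊆ Ω) :
    HasIntegrableWeakPartial (fun x => χ x * u x)
      (fun x => classicalPartial χ i x * u x + χ x * v x) i := by
  have hd := contDiff_classicalPartial hχ i
  have i1 := integrable_mul_of_tsupport_subset hχ.continuous hχs hχΩ h.1
  have i2 := integrable_mul_of_tsupport_subset hd.continuous
    (hasCompactSupport_classicalPartial hχs i)
    ((tsupport_classicalPartial_subset χ i).trans hχΩ) h.1
  have i3 := integrable_mul_of_tsupport_subset hχ.continuous hχs hχΩ h.2.1
  refine ⟨i1, i2.add i3, fun φ hφ hφs => ?_⟩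
  have hφd := contDiff_classicalPartial hφ i
  have h1 := h.2.2 (fun y => χ y * φ y) (hχ.mul hφ) hχs.mul_right
    ((tsupport_mul_subset_left).trans hχΩ)
  change ∫ x in Ω, u x * classicalPartial (fun y => χ y * φ y) i x = _ at h1
  change ∫ x, χ x * u x * classicalPartial φ i x = _
  simp_rw [classicalPartial_mul hχ hφ] at h1
  have hz : ∀ x, x ∉ Ω → χ x = 0 := fun x hx => image_eq_zero_of_notMem_tsupport fun h' => hx (hχΩ h')
  have hz' : ∀ x, x ∉ Ω → classicalPartial χ i x = 0 := fun x hx =>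
    image_eq_zero_of_notMem_tsupport fun h' =>
      hx (hχΩ (tsupport_classicalPartial_subset χ i h'))
  rw [setIntegral_eq_integral_of_forall_compl_eq_zero (fun x hx => by simp [hz x hx, hz' x hx]),
    setIntegral_eq_integral_of_forall_compl_eq_zero (fun x hx => by simp [hz x hx])] at h1
  have j1 : Integrable fun x => χ x * u x * classicalPartial φ i x :=
    i1.mul_of_top_left (hφd.continuous.memLp_top_of_hasCompactSupport
      (hasCompactSupport_classicalPartial hφs i) volume)
  have j2 : Integrable fun x => classicalPartial χ i x * u x * φ x :=
    i2.mul_of_top_left (hφ.continuous.memLp_top_of_hasCompactSupport hφs volume)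
  have j3 : Integrable fun x => χ x * v x * φ x :=
    i3.mul_of_top_left (hφ.continuous.memLp_top_of_hasCompactSupport hφs volume)
  have e1 : ∫ x, u x * (χ x * classicalPartial φ i x + φ x * classicalPartial χ i x) =
      (∫ x, χ x * u x * classicalPartial φ i x) + ∫ x, classicalPartial χ i x * u x * φ x := by
    rw [← integral_add j1 j2]
    congr 1; ext x; ring
  have e2 : ∫ x, v x * (χ x * φ x) = ∫ x, χ x * v x * φ x := by
    congr 1; ext x; ring
  have e3 : ∫ x, (classicalPartial χ i x * u x + χ x * v x) * φ x =
      (∫ x, classicalPartial χ i x * u x * φ x) + ∫ x, χ x * v x * φ x := by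
    rw [← integral_add j2 j3]
    congr 1; ext x; ring
  rw [e1, e2] at h1
  rw [e3]
  linarith

theorem HasIntegrableWeakPartial.add {w₁ w₂ W₁ W₂ : Euc n → ℝ} {i : Fin n}
    (h₁ : HasIntegrableWeakPartial w₁ W₁ i) (h₂ : HasIntegrableWeakPartial w₂ W₂ i) :
    HasIntegrableWeakPartial (fun x => w₁ x + w₂ x) (fun x => W₁ x + W₂ x) i := by
  refine ⟨h₁.1.add h₂.1, h₁.2.1.add h₂.2.1, fun φ hφ hφs => ?_⟩
  have hφd := (contDiff_classicalPartial hφ i).continuous.memLp_top_of_hasCompactSupport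
    (hasCompactSupport_classicalPartial hφs i) volume
  have hφt := hφ.continuous.memLp_top_of_hasCompactSupport hφs volume
  have e1 := integral_add (h₁.1.mul_of_top_left hφd) (h₂.1.mul_of_top_left hφd)
  have e2 := integral_add (h₁.2.1.mul_of_top_left hφt) (h₂.2.1.mul_of_top_left hφt)
  have a1 := h₁.2.2 φ hφ hφs
  have a2 := h₂.2.2 φ hφ hφs
  simp only [Pi.mul_apply] at e1 e2
  simp_rw [add_mul]
  change ∫ x, w₁ x * classicalPartial φ i x = _ at a1
  change ∫ x, w₂ x * classicalPartial φ i x = _ at a2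
  change ∫ x, (w₁ x * classicalPartial φ i x + w₂ x * classicalPartial φ i x) = _
  rw [e1, e2, a1, a2]
  ring

/-- A function that is twice weakly differentiable in `Ω` agrees on a given compact set, together
with its derivatives, with a compactly supported one on the whole space. -/
theorem exists_localization {Ω K : Set (Euc n)} (hΩ : IsOpen Ω) (hK : IsCompact K) (hKΩ : K ⊆ Ω)
    {u : Euc n → ℝ} {G : Fin n → Euc n → ℝ} {H : Fin n → Fin n → Euc n → ℝ}
    (hu : ContinuousOn u Ω) (hGm : ∀ i, Measurable (G i)) (hHm : ∀ i j, Measurable (H i j))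
    (hG : ∀ i, IsWeakPartial Ω u (G i) i) (hH : ∀ i j, IsWeakPartial Ω (G i) (H i j) j) :
    ∃ (w : Euc n → ℝ) (W : Fin n → Euc n → ℝ) (V : Fin n → Fin n → Euc n → ℝ),
      Continuous w ∧ (∀ i, Measurable (W i)) ∧ (∀ i j, Measurable (V i j)) ∧
      (∀ i, HasIntegrableWeakPartial w (W i) i) ∧
      (∀ i j, HasIntegrableWeakPartial (W i) (V i j) j) ∧
      ∀ y ∈ K, w y = u y ∧ (∀ i, W i y = G i y) ∧ ∀ i j, V i j y = H i j y := by
  obtain ⟨χ, hχ, hχs, hχΩ, hχ1⟩ := exists_cutoff hK hΩ hKΩ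
  have hcont : ∀ ψ : Euc n → ℝ, Continuous ψ → tsupport ψ ⊆ Ω → Continuous fun x => ψ x * u x := by
    intro ψ hψ hψΩ
    refine continuous_of_tsupport fun x hx => ?_
    have hxΩ : x ∈ Ω := hψΩ (tsupport_mul_subset_left hx)
    exact hψ.continuousAt.mul (hu.continuousAt (hΩ.mem_nhds hxΩ))
  have hd : ∀ i, ContDiff ℝ ∞ (classicalPartial χ i) := contDiff_classicalPartial hχ
  have hdd : ∀ i j, ContDiff ℝ ∞ (classicalPartial (classicalPartial χ i) j) :=
    fun i => contDiff_classicalPartial (hd i)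
  have hds : ∀ i, HasCompactSupport (classicalPartial χ i) :=
    hasCompactSupport_classicalPartial hχs
  have hdΩ : ∀ i, tsupport (classicalPartial χ i) ⊆ Ω :=
    fun i => (tsupport_classicalPartial_subset χ i).trans hχΩ
  have hddΩ : ∀ i j, tsupport (classicalPartial (classicalPartial χ i) j) ⊆ Ω :=
    fun i j => (tsupport_classicalPartial_subset _ j).trans (hdΩ i)
  refine ⟨fun x => χ x * u x, fun i x => classicalPartial χ i x * u x + χ x * G i x,
    fun i j x => (classicalPartial (classicalPartial χ i) j x * u x +
      classicalPartial χ i x * G j x) + (classicalPartial χ j x * G i x + χ x * H i j x),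
    hcont χ hχ.continuous hχΩ, fun i => ?_, fun i j => ?_, fun i => ?_, fun i j => ?_, ?_⟩
  · exact (hcont _ (hd i).continuous (hdΩ i)).measurable.add (hχ.continuous.measurable.mul (hGm i))
  · exact ((hcont _ (hdd i j).continuous (hddΩ i j)).measurable.add
      ((hd i).continuous.measurable.mul (hGm j))).add
      (((hd j).continuous.measurable.mul (hGm i)).add (hχ.continuous.measurable.mul (hHm i j)))
  · exact (hG i).cutoff_mul hχ hχs hχΩ
  · exact ((hG j).cutoff_mul (hd i) (hds i) (hdΩ i)).add ((hH i j).cutoff_mul hχ hχs hχΩ)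
  -- The cutoff is `1` in a neighbourhood of each point of `K`, so all Leibniz terms containing its
  -- derivatives vanish there.
  · intro y hy
    have h1 := hχ1 y hy
    have h2 : ∀ i, classicalPartial χ i =ᶠ[𝓝 y] fun _ => 0 := by
      intro i
      filter_upwards [h1.fderiv (𝕜 := ℝ)] with z hz
      simp [classicalPartial, hz]
    have h3 : ∀ i j, classicalPartial (classicalPartial χ i) j y = 0 := by
      intro i j
      rw [classicalPartial, (h2 i).fderiv_eq]
      simp
    have h1' := h1.self_of_nhds
    have h2' := fun i => (h2 i).self_of_nhds
    simp [h1', h2', h3]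

/-! ### Inequalities along rays -/

theorem enorm_sub_le_lintegral_of_hasDerivAt {p q : ℝ → ℝ} (hp : ∀ t, HasDerivAt p (q t) t)
    (hq : Continuous q) {a b : ℝ} (hab : a ≤ b) :
    ‖p b - p a‖ₑ ≤ ∫⁻ t in Ioc a b, ‖q t‖ₑ := by
  rw [← intervalIntegral.integral_eq_sub_of_hasDerivAt (fun t _ => hp t)
    (hq.intervalIntegrable a b), intervalIntegral.integral_of_le hab]
  exact enorm_integral_le_lintegral_enorm _

/-- The first-order bound is applied to `p` minus its tangent part and then to `q`. The Taylor
weight `b - t` is replaced by `b`, which gives the factor that later cancels against `T + T'`. -/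
theorem enorm_sub_sub_mul_le_lintegral {p q r : ℝ → ℝ} (hp : ∀ t, HasDerivAt p (q t) t)
    (hq : ∀ t, HasDerivAt q (r t) t) (hr : Continuous r) {b : ℝ} (hb : 0 ≤ b) :
    ‖p b - p 0 - b * q 0‖ₑ ≤ ENNReal.ofReal b * ∫⁻ t in Ioc 0 b, ‖r t‖ₑ := by
  have hqc : Continuous q := continuous_iff_continuousAt.2 fun t => (hq t).continuousAt
  have h1 := enorm_sub_le_lintegral_of_hasDerivAt (p := fun t => p t - t * q 0)
    (q := fun t => q t - q 0)
    (fun t => by simpa using (hp t).fun_sub ((hasDerivAt_id t).mul_const (q 0)))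
    (hqc.sub continuous_const) hb
  have h2 : p b - p 0 - b * q 0 = p b - b * q 0 - (p 0 - 0 * q 0) := by ring
  rw [h2]
  refine h1.trans ?_
  calc ∫⁻ t in Ioc 0 b, ‖q t - q 0‖ₑ ≤ ∫⁻ _ in Ioc 0 b, ∫⁻ s in Ioc 0 b, ‖r s‖ₑ := by
        refine setLIntegral_mono' measurableSet_Ioc fun t ht => ?_
        exact (enorm_sub_le_lintegral_of_hasDerivAt hq hr ht.1.le).trans
          (lintegral_mono_set (Ioc_subset_Ioc_right ht.2))
    _ = _ := by simp [mul_comm]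

theorem hasDerivAt_comp_ray {f : Euc n → ℝ} (hf : ContDiff ℝ ∞ f) (x θ : Euc n) (t : ℝ) :
    HasDerivAt (fun t : ℝ => f (x + t • θ)) (∑ i, θ i * classicalPartial f i (x + t • θ)) t := by
  have h1 : HasDerivAt (fun t : ℝ => x + t • θ) θ t := by
    simpa using ((hasDerivAt_id t).smul_const θ).const_add x
  have h2 := ((hf.differentiable (by simp)) (x + t • θ)).hasFDerivAt.comp_hasDerivAt t h1
  have h3 : fderiv ℝ f (x + t • θ) θ = ∑ i, θ i * classicalPartial f i (x + t • θ) := by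
    have : θ = ∑ i, θ i • (EuclideanSpace.single i (1 : ℝ)) := by
      simpa using ((EuclideanSpace.basisFun (Fin n) ℝ).sum_repr θ).symm
    conv_lhs => rw [congrArg (fderiv ℝ f (x + t • θ)) this]
    rw [map_sum]
    simp [classicalPartial]
  rw [← h3]
  exact h2

theorem classicalPartial_mollify {w W : Euc n → ℝ} {i : Fin n} (h : HasIntegrableWeakPartial w W i)
    (φ : ContDiffBump (0 : Euc n)) : classicalPartial (mollify φ w) i = mollify φ W :=
  funext fun x => fderiv_mollify h φ x

theorem abs_apply_le_one {θ : Euc n} (hθ : ‖θ‖ = 1) (i : Fin n) : |θ i| ≤ 1 := by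
  have := PiLp.norm_apply_le θ i
  rwa [hθ] at this

theorem lintegral_enorm_sum_mollify_le {ι : Type*} [Fintype ι] {V : ι → Euc n → ℝ}
    (hVm : ∀ k, Measurable (V k)) (hV : ∀ k, Integrable (V k)) {c : ι → ℝ} (hc : ∀ k, |c k| ≤ 1)
    (φ : ContDiffBump (0 : Euc n)) (x θ : Euc n) (s : Set ℝ) :
    ∫⁻ t in s, ‖∑ k, c k * mollify φ (V k) (x + t • θ)‖ₑ ≤
      (∫⁻ t in s, ‖∑ k, c k * V k (x + t • θ)‖ₑ) +
        ∑ k, ∫⁻ t in s, ‖mollify φ (V k) (x + t • θ) - V k (x + t • θ)‖ₑ := by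
  have hd : ∀ k, Measurable fun y => ‖mollify φ (V k) y - V k y‖ₑ := fun k =>
    ((contDiff_mollify φ (hV k).locallyIntegrable).continuous.measurable.sub (hVm k)).enorm
  rw [← lintegral_finsetSum _ fun k _ => (hd k).comp_ray x θ,
    ← lintegral_add_right _ (Finset.measurable_sum _ fun k _ => (hd k).comp_ray x θ)]
  refine lintegral_mono fun t => ?_
  have h1 : ∑ k, c k * mollify φ (V k) (x + t • θ) = ∑ k, c k * V k (x + t • θ) +
      ∑ k, c k * (mollify φ (V k) (x + t • θ) - V k (x + t • θ)) := by
    rw [← Finset.sum_add_distrib]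
    exact Finset.sum_congr rfl fun k _ => by ring
  rw [h1]
  refine (enorm_add_le _ _).trans ?_
  gcongr
  refine (enorm_sum_le _ _).trans (Finset.sum_le_sum fun k _ => ?_)
  rw [enorm_mul]
  have : ‖c k‖ₑ ≤ 1 := by
    rw [← ofReal_norm]
    exact ENNReal.ofReal_le_one.2 (hc k)
  exact mul_le_of_le_one_left' this

theorem measurable_enorm_mollify_sub (φ : ContDiffBump (0 : Euc n)) {f : Euc n → ℝ}
    (hfm : Measurable f) (hf : Integrable f) : Measurable fun y => ‖mollify φ f y - f y‖ₑ :=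
  ((contDiff_mollify φ hf.locallyIntegrable).continuous.measurable.sub hfm).enorm

theorem tendsto_mollify_of_continuous {φ : ℕ → ContDiffBump (0 : Euc n)}
    (hφ : Tendsto (fun j => (φ j).rOut) atTop (𝓝 0)) {w : Euc n → ℝ} (hw : Continuous w)
    (x : Euc n) : Tendsto (fun j => mollify (φ j) w x) atTop (𝓝 (w x)) :=
  ContDiffBump.convolution_tendsto_right_of_continuous hφ hw x

/-- The fundamental theorem of calculus is used for the mollified functions on `[a, b]` with `a >
0`, where the errors vanish along almost every ray from any given `x`. Continuity of `w` then allows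
`a → 0`. -/
theorem HasIntegrableWeakPartial.ae_ray_le (hn : 0 < n) {w : Euc n → ℝ} {W : Fin n → Euc n → ℝ}
    (hw : Continuous w) (hWm : ∀ i, Measurable (W i))
    (hW : ∀ i, HasIntegrableWeakPartial w (W i) i) (x : Euc n) :
    ∀ᵐ θ ∂sphereMeasure n, ∀ b : ℝ, 0 < b →
      ‖w (x + b • θ) - w x‖ₑ ≤ ∫⁻ t in Ioc 0 b, ‖∑ i, θ i * W i (x + t • θ)‖ₑ := by
  obtain ⟨φ, hφ, hfast⟩ := exists_fast_mollifiers fun i => (hW i).2.1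
  have hray := fun i => ae_tendsto_lintegral_ray_of_pos hn
    (fun j => measurable_enorm_mollify_sub (φ j) (hWm i) (hW i).2.1) (hfast i) x
  filter_upwards [ae_all_iff.2 hray, ae_sphereMeasure_norm_eq_one] with θ hθ hθ1 b hb
  have key : ∀ a ∈ Ioo 0 b, ‖w (x + b • θ) - w (x + a • θ)‖ₑ ≤
      ∫⁻ t in Ioc 0 b, ‖∑ i, θ i * W i (x + t • θ)‖ₑ := by
    intro a ha
    have h1 : Tendsto (fun j => ‖mollify (φ j) w (x + b • θ) - mollify (φ j) w (x + a • θ)‖ₑ)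
        atTop (𝓝 ‖w (x + b • θ) - w (x + a • θ)‖ₑ) :=
      ((tendsto_mollify_of_continuous hφ hw _).sub (tendsto_mollify_of_continuous hφ hw _)).enorm
    have h2 : Tendsto (fun j => (∫⁻ t in Ioc 0 b, ‖∑ i, θ i * W i (x + t • θ)‖ₑ) +
        ∑ i, ∫⁻ t in Ioi a, ‖mollify (φ j) (W i) (x + t • θ) - W i (x + t • θ)‖ₑ) atTop
        (𝓝 ((∫⁻ t in Ioc 0 b, ‖∑ i, θ i * W i (x + t • θ)‖ₑ) + ∑ i : Fin n, 0)) :=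
      tendsto_const_nhds.add (tendsto_finsetSum _ fun i _ => hθ i a ha.1)
    rw [Finset.sum_const_zero, add_zero] at h2
    refine le_of_tendsto_of_tendsto' h1 h2 fun j => ?_
    have hc := contDiff_mollify (φ j) hw.locallyIntegrable
    refine (enorm_sub_le_lintegral_of_hasDerivAt (hasDerivAt_comp_ray hc x θ) ?_ ha.2.le).trans ?_
    · refine continuous_finsetSum _ fun i _ => continuous_const.mul ?_
      exact (contDiff_classicalPartial hc i).continuous.comp (by fun_prop)
    · simp_rw [fun i => classicalPartial_mollify (hW i) (φ j)]
      refine (lintegral_enorm_sum_mollify_le hWm (fun i => (hW i).2.1) (abs_apply_le_one hθ1)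
        (φ j) x θ _).trans ?_
      gcongr with i
      · exact ha.1.le
      · exact Ioc_subset_Ioi_self
  have h3 : Tendsto (fun a : ℝ => ‖w (x + b • θ) - w (x + a • θ)‖ₑ) (𝓝[>] 0)
      (𝓝 ‖w (x + b • θ) - w (x + (0 : ℝ) • θ)‖ₑ) :=
    ((by fun_prop : Continuous fun a : ℝ => ‖w (x + b • θ) - w (x + a • θ)‖ₑ).tendsto 0).mono_left
      nhdsWithin_le_nhds
  rw [zero_smul, add_zero] at h3
  exact le_of_tendsto h3 (by filter_upwards [Ioo_mem_nhdsGT hb] with a ha using key a ha)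

/-- Second-order Taylor for the mollified functions. One mollifier sequence, chosen for all first
and second derivatives together, gives convergence of the gradients at `x` and of the Hessians along
rays from `x`, each for almost every `x`. -/
theorem HasIntegrableWeakPartial.ae_ae_ray_sub_le (hn : 0 < n) {w : Euc n → ℝ}
    {W : Fin n → Euc n → ℝ} {V : Fin n → Fin n → Euc n → ℝ} (hw : Continuous w)
    (hWm : ∀ i, Measurable (W i)) (hVm : ∀ i j, Measurable (V i j))
    (hW : ∀ i, HasIntegrableWeakPartial w (W i) i)
    (hV : ∀ i j, HasIntegrableWeakPartial (W i) (V i j) j) :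
    ∀ᵐ x, ∀ᵐ θ ∂sphereMeasure n, ∀ b : ℝ, 0 < b →
      ‖w (x + b • θ) - w x - b * ∑ i, θ i * W i x‖ₑ ≤
        ENNReal.ofReal b * ∫⁻ t in Ioc 0 b,
          ‖∑ p : Fin n × Fin n, θ p.1 * θ p.2 * V p.1 p.2 (x + t • θ)‖ₑ := by
  obtain ⟨φ, hφ, hfast⟩ := exists_fast_mollifiers
    (f := fun k : Fin n ⊕ Fin n × Fin n => Sum.elim W (fun p => V p.1 p.2) k)
    (by rintro (i | p); exacts [(hW i).2.1, (hV p.1 p.2).2.1])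
  -- Summable `L¹` errors have an almost everywhere finite sum, so the convergence is pointwise
  -- without passing to a subsequence.
  have hpt : ∀ i, ∀ᵐ x, Tendsto (fun j => mollify (φ j) (W i) x) atTop (𝓝 (W i x)) := by
    intro i
    have h1 := hfast (Sum.inl i)
    have hm : ∀ j, Measurable fun y => ‖mollify (φ j) (W i) y - W i y‖ₑ :=
      fun j => measurable_enorm_mollify_sub (φ j) (hWm i) (hW i).2.1
    simp only [Sum.elim_inl] at h1
    rw [← lintegral_tsum fun j => (hm j).aemeasurable] at h1
    filter_upwards [ae_lt_top' (Measurable.tsum hm).aemeasurable h1] with x hx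
    have h2 := ENNReal.tendsto_atTop_zero_of_tsum_ne_top hx.ne
    rw [tendsto_iff_edist_tendsto_0]
    simpa [edist_eq_enorm_sub] using h2
  have hray := fun p : Fin n × Fin n => ae_tendsto_lintegral_ray hn
    (fun j => measurable_enorm_mollify_sub (φ j) (hVm p.1 p.2) (hV p.1 p.2).2.1)
    (hfast (Sum.inr p))
  filter_upwards [ae_all_iff.2 hpt, ae_all_iff.2 hray] with x hx hxray
  filter_upwards [ae_all_iff.2 hxray, ae_sphereMeasure_norm_eq_one] with θ hθ hθ1 b hb
  have h1 : Tendsto (fun j => ‖mollify (φ j) w (x + b • θ) - mollify (φ j) w x -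
      b * ∑ i, θ i * mollify (φ j) (W i) x‖ₑ) atTop
      (𝓝 ‖w (x + b • θ) - w x - b * ∑ i, θ i * W i x‖ₑ) :=
    (((tendsto_mollify_of_continuous hφ hw _).sub (tendsto_mollify_of_continuous hφ hw _)).sub
      ((tendsto_finsetSum _ fun i _ => (hx i).const_mul _).const_mul b)).enorm
  have h2 : Tendsto (fun j => ENNReal.ofReal b * ((∫⁻ t in Ioc 0 b,
        ‖∑ p : Fin n × Fin n, θ p.1 * θ p.2 * V p.1 p.2 (x + t • θ)‖ₑ) +
      ∑ p : Fin n × Fin n, ∫⁻ t in Ioi (0 : ℝ),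
        ‖mollify (φ j) (V p.1 p.2) (x + t • θ) - V p.1 p.2 (x + t • θ)‖ₑ)) atTop
      (𝓝 (ENNReal.ofReal b * ((∫⁻ t in Ioc 0 b,
        ‖∑ p : Fin n × Fin n, θ p.1 * θ p.2 * V p.1 p.2 (x + t • θ)‖ₑ) +
        ∑ p : Fin n × Fin n, 0))) :=
    ENNReal.Tendsto.const_mul (tendsto_const_nhds.add (tendsto_finsetSum _ fun p _ => hθ p))
      (Or.inr ENNReal.ofReal_ne_top)
  rw [Finset.sum_const_zero, add_zero] at h2
  refine le_of_tendsto_of_tendsto' h1 h2 fun j => ?_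
  have hc := contDiff_mollify (φ j) hw.locallyIntegrable
  have hcW := fun i => contDiff_mollify (φ j) (hW i).2.1.locallyIntegrable
  have hp : ∀ t, HasDerivAt (fun t : ℝ => mollify (φ j) w (x + t • θ))
      (∑ i, θ i * mollify (φ j) (W i) (x + t • θ)) t := by
    intro t
    have := hasDerivAt_comp_ray hc x θ t
    simpa only [fun i => classicalPartial_mollify (hW i) (φ j)] using this
  have hq : ∀ t, HasDerivAt (fun t : ℝ => ∑ i, θ i * mollify (φ j) (W i) (x + t • θ))
      (∑ p : Fin n × Fin n, θ p.1 * θ p.2 * mollify (φ j) (V p.1 p.2) (x + t • θ)) t := by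
    intro t
    have h3 := HasDerivAt.fun_sum (u := Finset.univ) fun i _ =>
      (hasDerivAt_comp_ray (hcW i) x θ t).const_mul (θ i)
    simp only [fun i k => classicalPartial_mollify (hV i k) (φ j)] at h3
    refine h3.congr_deriv ?_
    symm
    rw [Fintype.sum_prod_type]
    refine Finset.sum_congr rfl fun i _ => ?_
    rw [Finset.mul_sum]
    exact Finset.sum_congr rfl fun k _ => by ring
  have hr : Continuous fun t : ℝ =>
      ∑ p : Fin n × Fin n, θ p.1 * θ p.2 * mollify (φ j) (V p.1 p.2) (x + t • θ) := by
    refine continuous_finsetSum _ fun p _ => continuous_const.mul ?_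
    exact (contDiff_mollify (φ j) (hV p.1 p.2).2.1.locallyIntegrable).continuous.comp
      (by fun_prop)
  have h4 := enorm_sub_sub_mul_le_lintegral hp hq hr hb.le
  simp only [zero_smul, add_zero] at h4
  refine h4.trans ?_
  gcongr
  refine (lintegral_enorm_sum_mollify_le (V := fun p : Fin n × Fin n => V p.1 p.2)
    (c := fun p => θ p.1 * θ p.2) (fun p => hVm p.1 p.2)
    (fun p => (hV p.1 p.2).2.1) (fun p => ?_) (φ j) x θ _).trans ?_
  · rw [abs_mul]
    exact mul_le_one₀ (abs_apply_le_one hθ1 _) (abs_nonneg _) (abs_apply_le_one hθ1 _)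
  · gcongr
    exact Ioc_subset_Ioi_self

/-- The `m`-th set consists of points of norm at most `m` at distance at least `1 / (m + 1)` from
the complement. Countability of the family lets a single null set serve all segments in `Ω`. -/
theorem IsOpen.exists_compact_exhaustion_subset {Ω : Set (Euc n)} (hΩ : IsOpen Ω) :
    ∃ K : ℕ → Set (Euc n), (∀ m, IsCompact (K m)) ∧ (∀ m, K m ⊆ Ω) ∧
      ∀ L, IsCompact L → L ⊆ Ω → ∃ m, L ⊆ K m := by
  refine ⟨fun m => closedBall 0 m ∩ (thickening (1 / ((m : ℝ) + 1)) Ωᶜ)ᶜ, fun m => ?_,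
    fun m y hy => ?_, fun L hL hLΩ => ?_⟩
  · exact (isCompact_closedBall _ _).inter_right isOpen_thickening.isClosed_compl
  · by_contra hyΩ
    exact hy.2 (self_subset_thickening (by positivity) _ hyΩ)
  · obtain ⟨δ, hδ, hLδ⟩ := hL.exists_thickening_subset_open hΩ hLΩ
    obtain ⟨R, hR⟩ := hL.isBounded.subset_closedBall 0
    obtain ⟨m₁, hm₁⟩ := exists_nat_ge R
    obtain ⟨m₂, hm₂⟩ := exists_nat_one_div_lt hδ
    refine ⟨max m₁ m₂, fun y hy => ⟨?_, fun hy' => ?_⟩⟩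
    · refine closedBall_subset_closedBall ?_ (hR hy)
      exact hm₁.trans (by exact_mod_cast le_max_left _ _)
    · obtain ⟨z, hz, hyz⟩ := mem_thickening_iff.1 hy'
      refine hz (hLδ (mem_thickening_iff.2 ⟨y, hy, ?_⟩))
      rw [dist_comm]
      refine hyz.trans_le (le_trans ?_ hm₂.le)
      gcongr
      exact le_max_right _ _

theorem inner_eq_sum_mul (v θ : Euc n) : inner ℝ v θ = ∑ i, θ i * v i := by
  simp [PiLp.inner_apply]

/-- Cauchy–Schwarz, as the matrix with entries `θ i * θ j` has Frobenius norm `1`. -/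
theorem enorm_sum_mul_le_matrixAbs {θ : Euc n} (hθ : ‖θ‖ = 1) (A : Matrix (Fin n) (Fin n) ℝ) :
    ‖∑ p : Fin n × Fin n, θ p.1 * θ p.2 * A p.1 p.2‖ₑ ≤ ENNReal.ofReal (matrixAbs A) := by
  rw [← ofReal_norm]
  refine ENNReal.ofReal_le_ofReal (Real.abs_le_sqrt ?_)
  have h1 : ∑ i, θ i ^ 2 = 1 := by
    have := EuclideanSpace.real_norm_sq_eq θ
    rw [← this, hθ, one_pow]
  have h2 : ∑ p : Fin n × Fin n, (θ p.1 * θ p.2) ^ 2 = 1 := by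
    simp_rw [Fintype.sum_prod_type, mul_pow, ← Finset.mul_sum, h1, mul_one]
    exact h1
  have h3 := Finset.sum_mul_sq_le_sq_mul_sq Finset.univ
    (fun p : Fin n × Fin n => θ p.1 * θ p.2) (fun p => A p.1 p.2)
  rw [h2, one_mul, Fintype.sum_prod_type (f := fun p : Fin n × Fin n => A p.1 p.2 ^ 2)] at h3
  exact h3

theorem isCompact_image_ray (x θ : Euc n) (b : ℝ) :
    IsCompact ((fun t : ℝ => x + t • θ) '' Icc 0 b) :=
  isCompact_Icc.image (by fun_prop)

section WeakRay

variable {Ω : Set (Euc n)} {u : Euc n → ℝ} {G : Euc n → Euc n}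
  {H : Euc n → Matrix (Fin n) (Fin n) ℝ}

theorem ae_ray_le (hn : 0 < n) (hΩ : IsOpen Ω) (hu : ContinuousOn u Ω)
    (hGm : ∀ i, Measurable fun x => G x i) (hHm : ∀ i j, Measurable fun x => H x i j)
    (hG : IsWeakGradient Ω u G)
    (hH : ∀ i j, IsWeakPartial Ω (fun x => G x i) (fun x => H x i j) j) (x : Euc n) :
    ∀ᵐ θ ∂sphereMeasure n, ∀ b : ℝ, 0 < b → (∀ t ∈ Icc 0 b, x + t • θ ∈ Ω) →
      ‖u (x + b • θ) - u x‖ₑ ≤ ∫⁻ t in Ioc 0 b, ‖G (x + t • θ)‖ₑ := by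
  obtain ⟨K, hK, hKΩ, hKe⟩ := hΩ.exists_compact_exhaustion_subset
  have hloc := fun m => exists_localization hΩ (hK m) (hKΩ m) hu hGm hHm hG hH
  choose w W V hw hWm hVm hW hV heq using hloc
  have hray := fun m => HasIntegrableWeakPartial.ae_ray_le hn (hw m) (hWm m) (hW m) x
  filter_upwards [ae_all_iff.2 hray, ae_sphereMeasure_norm_eq_one] with θ hθ hθ1 b hb hbΩ
  -- The segment is compact, hence lies in one set of the exhaustion, where the localized function
  -- and its derivatives agree with the given ones.
  obtain ⟨m, hm⟩ := hKe _ (isCompact_image_ray x θ b) (image_subset_iff.2 hbΩ)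
  have hmem : ∀ t ∈ Icc 0 b, x + t • θ ∈ K m := fun t ht => hm ⟨t, ht, rfl⟩
  have h1 := hθ m b hb
  have hx0 : x ∈ K m := by simpa using hmem 0 ⟨le_refl (0 : ℝ), hb.le⟩
  rw [(heq m _ (hmem b ⟨hb.le, le_rfl⟩)).1, (heq m x hx0).1] at h1
  refine h1.trans (setLIntegral_mono' measurableSet_Ioc fun t ht => ?_)
  simp_rw [(heq m _ (hmem t ⟨ht.1.le, ht.2⟩)).2.1]
  rw [← inner_eq_sum_mul, ← ofReal_norm, ← ofReal_norm]
  refine ENNReal.ofReal_le_ofReal ((norm_inner_le_norm _ _).trans ?_)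
  rw [hθ1, mul_one]

theorem ae_ae_ray_sub_le (hn : 0 < n) (hΩ : IsOpen Ω) (hu : ContinuousOn u Ω)
    (hGm : ∀ i, Measurable fun x => G x i) (hHm : ∀ i j, Measurable fun x => H x i j)
    (hG : IsWeakGradient Ω u G)
    (hH : ∀ i j, IsWeakPartial Ω (fun x => G x i) (fun x => H x i j) j) :
    ∀ᵐ x, ∀ᵐ θ ∂sphereMeasure n, ∀ b : ℝ, 0 < b → (∀ t ∈ Icc 0 b, x + t • θ ∈ Ω) →
      ‖u (x + b • θ) - u x - b * inner ℝ (G x) θ‖ₑ ≤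
        ENNReal.ofReal b * ∫⁻ t in Ioc 0 b, ENNReal.ofReal (matrixAbs (H (x + t • θ))) := by
  obtain ⟨K, hK, hKΩ, hKe⟩ := hΩ.exists_compact_exhaustion_subset
  have hloc := fun m => exists_localization hΩ (hK m) (hKΩ m) hu hGm hHm hG hH
  choose w W V hw hWm hVm hW hV heq using hloc
  have hray := fun m =>
    HasIntegrableWeakPartial.ae_ae_ray_sub_le hn (hw m) (hWm m) (hVm m) (hW m) (hV m)
  filter_upwards [ae_all_iff.2 hray] with x hx
  filter_upwards [ae_all_iff.2 hx, ae_sphereMeasure_norm_eq_one] with θ hθ hθ1 b hb hbΩ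
  obtain ⟨m, hm⟩ := hKe _ (isCompact_image_ray x θ b) (image_subset_iff.2 hbΩ)
  have hmem : ∀ t ∈ Icc 0 b, x + t • θ ∈ K m := fun t ht => hm ⟨t, ht, rfl⟩
  have h1 := hθ m b hb
  have hx0 : x ∈ K m := by simpa using hmem 0 ⟨le_refl (0 : ℝ), hb.le⟩
  simp_rw [(heq m x hx0).2.1] at h1
  rw [(heq m _ (hmem b ⟨hb.le, le_rfl⟩)).1, (heq m x hx0).1, ← inner_eq_sum_mul] at h1
  refine h1.trans ?_
  refine mul_le_mul' le_rfl (setLIntegral_mono' measurableSet_Ioc fun t ht => ?_)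
  simp_rw [(heq m _ (hmem t ⟨ht.1.le, ht.2⟩)).2.2]
  exact enorm_sum_mul_le_matrixAbs hθ1 _

end WeakRay

/-! ### The first boundary point -/

section Zeta

variable {Ω : Set (Euc n)} {x θ : Euc n}

/-- A connected segment avoiding the boundary cannot meet both `Ω` and the exterior `(closure Ω)ᶜ`.
-/
theorem add_smul_mem_of_forall_notMem_frontier (hΩ : IsOpen Ω) (hx : x ∈ Ω) {s : ℝ} (hs : 0 ≤ s)
    (h : ∀ r ∈ Icc 0 s, x + r • θ ∉ frontier Ω) : x + s • θ ∈ Ω := by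
  by_contra hc
  have hpre : IsPreconnected ((fun s : ℝ => x + s • θ) '' Icc 0 s) :=
    isPreconnected_Icc.image _ (by fun_prop)
  have hout : ∀ r ∈ Icc 0 s, x + r • θ ∉ Ω → x + r • θ ∈ (closure Ω)ᶜ := fun r hr h1 h2 =>
    h r hr (by rw [hΩ.frontier_eq]; exact ⟨h2, h1⟩)
  obtain ⟨y, -, hy1, hy2⟩ := hpre Ω (closure Ω)ᶜ hΩ isClosed_closure.isOpen_compl
    (by
      rintro _ ⟨r, hr, rfl⟩
      by_cases h' : x + r • θ ∈ Ω
      · exact Or.inl h'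
      · exact Or.inr (hout r hr h'))
    ⟨x, ⟨0, ⟨le_rfl, hs⟩, by simp⟩, hx⟩
    ⟨_, ⟨s, ⟨hs, le_rfl⟩, rfl⟩, hout s ⟨hs, le_rfl⟩ hc⟩
  exact hy2 (subset_closure hy1)

theorem notMem_frontier_of_mem (hΩ : IsOpen Ω) {y : Euc n} (hy : y ∈ Ω) : y ∉ frontier Ω :=
  fun hf => by rw [hΩ.frontier_eq] at hf; exact hf.2 hy

theorem hitTimes_eq (hΩ : IsOpen Ω) (hx : x ∈ Ω) :
    hitTimes Ω x θ = Ici 0 ∩ (fun s : ℝ => x + s • θ) ⁻¹' frontier Ω := by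
  ext s
  refine ⟨fun h => ⟨h.1.le, h.2⟩, fun h => ⟨lt_of_le_of_ne h.1 ?_, h.2⟩⟩
  rintro rfl
  exact notMem_frontier_of_mem hΩ hx (by simpa using h.2)

theorem bddBelow_hitTimes : BddBelow (hitTimes Ω x θ) := ⟨0, fun _ hs => hs.1.le⟩

theorem sInf_hitTimes_mem (hΩ : IsOpen Ω) (hx : x ∈ Ω) (hne : (hitTimes Ω x θ).Nonempty) :
    sInf (hitTimes Ω x θ) ∈ hitTimes Ω x θ := by
  refine IsClosed.csInf_mem ?_ hne bddBelow_hitTimes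
  rw [hitTimes_eq hΩ hx]
  exact isClosed_Ici.inter (isClosed_frontier.preimage (by fun_prop))

theorem add_smul_mem_of_lt_sInf (hΩ : IsOpen Ω) (hx : x ∈ Ω) {s : ℝ} (hs : 0 ≤ s)
    (h : s < sInf (hitTimes Ω x θ)) : x + s • θ ∈ Ω := by
  refine add_smul_mem_of_forall_notMem_frontier hΩ hx hs fun r hr hrf => ?_
  have : r ∈ hitTimes Ω x θ := by rw [hitTimes_eq hΩ hx]; exact ⟨hr.1, hrf⟩
  linarith [csInf_le bddBelow_hitTimes this, hr.2]

theorem add_smul_mem_of_hitTimes_eq_empty (hΩ : IsOpen Ω) (hx : x ∈ Ω)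
    (h : ¬ (hitTimes Ω x θ).Nonempty) {s : ℝ} (hs : 0 ≤ s) : x + s • θ ∈ Ω := by
  refine add_smul_mem_of_forall_notMem_frontier hΩ hx hs fun r hr hrf => h ⟨r, ?_⟩
  rw [hitTimes_eq hΩ hx]; exact ⟨hr.1, hrf⟩

/-- Compactness of `[0, c]` (tube lemma). Measurability in `θ` of the first hitting time rests on
these sets. -/
theorem isOpen_setOf_segment_subset (hΩ : IsOpen Ω) (x : Euc n) (c : ℝ) :
    IsOpen {θ : Euc n | ∀ t ∈ Icc 0 c, x + t • θ ∈ Ω} := by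
  rw [isOpen_iff_mem_nhds]
  intro θ hθ
  refine isCompact_Icc.eventually_forall_of_forall_eventually
    (P := fun (θ : Euc n) (t : ℝ) => x + t • θ ∈ Ω) fun t ht => ?_
  have hc : Continuous fun z : Euc n × ℝ => x + z.2 • z.1 := by fun_prop
  exact (hΩ.preimage hc).mem_nhds (hθ t ht)

theorem hitTimes_nonempty_iff (hΩ : IsOpen Ω) (hx : x ∈ Ω) :
    (hitTimes Ω x θ).Nonempty ↔ ∃ c : ℕ, ¬ ∀ t ∈ Icc (0 : ℝ) c, x + t • θ ∈ Ω := by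
  constructor
  · rintro ⟨t, ht0, ht⟩
    obtain ⟨c, hc⟩ := exists_nat_ge t
    exact ⟨c, fun h => notMem_frontier_of_mem hΩ (h t ⟨ht0.le, hc⟩) ht⟩
  · rintro ⟨c, hc⟩
    by_contra h
    exact hc fun t ht => add_smul_mem_of_hitTimes_eq_empty hΩ hx h ht.1

theorem measurableSet_hitTimes_nonempty (hΩ : IsOpen Ω) (hx : x ∈ Ω) :
    MeasurableSet {θ : Euc n | (hitTimes Ω x θ).Nonempty} := by
  simp_rw [hitTimes_nonempty_iff hΩ hx, ofPred_exists]
  exact MeasurableSet.iUnion fun c => (isOpen_setOf_segment_subset hΩ x c).measurableSet.compl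

theorem measurable_sInf_hitTimes (hΩ : IsOpen Ω) (hx : x ∈ Ω) :
    Measurable fun θ : Euc n => sInf (hitTimes Ω x θ) := by
  refine measurable_of_Ioi fun c => ?_
  rcases lt_or_ge c 0 with hc | hc
  · convert MeasurableSet.univ
    refine eq_univ_of_forall fun θ => ?_
    exact lt_of_lt_of_le hc (Real.sInf_nonneg fun t ht => ht.1.le)
  -- For `c ≥ 0` a hitting time exceeds `c` exactly when the closed segment up to `c` stays in `Ω`.
  -- The intersection removes the rays that never hit, for which `sInf ∅ = 0`.
  · convert (measurableSet_hitTimes_nonempty hΩ hx).inter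
      (isOpen_setOf_segment_subset hΩ x c).measurableSet using 1
    ext θ
    simp only [mem_preimage, mem_Ioi, mem_inter_iff, mem_ofPred_eq]
    constructor
    · intro h
      refine ⟨?_, fun t ht => add_smul_mem_of_lt_sInf hΩ hx ht.1 (ht.2.trans_lt h)⟩
      by_contra hne
      rw [not_nonempty_iff_eq_empty.1 hne, Real.sInf_empty] at h
      linarith
    · rintro ⟨hne, h⟩
      have hT := sInf_hitTimes_mem hΩ hx hne
      by_contra hle
      exact notMem_frontier_of_mem hΩ (h _ ⟨hT.1.le, not_lt.1 hle⟩) hT.2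

/-- As `g` is measurable only on the boundary, it is first replaced by its extension by zero; `zeta`
takes values in the closed set `frontier Ω` wherever the ray hits. -/
theorem measurable_compZeta (hΩ : IsOpen Ω) (hx : x ∈ Ω) {g : Euc n → ℝ}
    (hg : Measurable fun y : frontier Ω => g y) : Measurable fun θ => compZeta Ω g x θ := by
  have he : MeasurableEmbedding (Subtype.val : frontier Ω → Euc n) :=
    MeasurableEmbedding.subtype_coe isClosed_frontier.measurableSet
  have hg' := he.measurable_extend hg (measurable_const (a := (0 : ℝ)))
  have h1 : Measurable fun θ : Euc n => x + sInf (hitTimes Ω x θ) • θ :=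
    measurable_const.add ((measurable_sInf_hitTimes hΩ hx).smul measurable_id)
  convert (hg'.comp h1).indicator (measurableSet_hitTimes_nonempty hΩ hx) using 2 with θ
  by_cases hne : (hitTimes Ω x θ).Nonempty
  · have hT := sInf_hitTimes_mem hΩ hx hne
    rw [compZeta, if_pos hne, indicator_of_mem (show θ ∈ {θ | (hitTimes Ω x θ).Nonempty} from hne)]
    exact (Subtype.val_injective.extend_apply (fun y : frontier Ω => g y) _ ⟨_, hT.2⟩).symm
  · rw [compZeta, if_neg hne, indicator_of_notMem (show θ ∉ {θ | (hitTimes Ω x θ).Nonempty} from hne)]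

end Zeta

/-! ### Uniqueness of weak derivatives and measurable representatives -/

theorem IsWeakPartial.congr {Ω : Set (Euc n)} {u u' v v' : Euc n → ℝ} {i : Fin n}
    (h : IsWeakPartial Ω u v i) (hu : u =ᵐ[volume.restrict Ω] u')
    (hv : v =ᵐ[volume.restrict Ω] v') : IsWeakPartial Ω u' v' i := by
  refine ⟨h.1.congr hu, h.2.1.congr hv, fun φ hφ hφs hφΩ => ?_⟩
  have e1 : ∫ x in Ω, u' x * fderiv ℝ φ x (EuclideanSpace.single i 1) =
      ∫ x in Ω, u x * fderiv ℝ φ x (EuclideanSpace.single i 1) :=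
    integral_congr_ae (by filter_upwards [hu] with x hx; rw [hx])
  have e2 : ∫ x in Ω, v' x * φ x = ∫ x in Ω, v x * φ x :=
    integral_congr_ae (by filter_upwards [hv] with x hx; rw [hx])
  rw [e1, e2]
  exact h.2.2 φ hφ hφs hφΩ

theorem IsWeakPartial.ae_eq {Ω : Set (Euc n)} (hΩ : IsOpen Ω) {u v v' : Euc n → ℝ} {i : Fin n}
    (h : IsWeakPartial Ω u v i) (h' : IsWeakPartial Ω u v' i) : v =ᵐ[volume.restrict Ω] v' := by
  have h0 : ∀ᵐ x, x ∈ Ω → (v - v') x = 0 := by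
    refine hΩ.ae_eq_zero_of_integral_contDiff_smul_eq_zero (h.2.1.sub h'.2.1)
      fun φ hφ hφs hφΩ => ?_
    have e1 := h.2.2 φ hφ hφs hφΩ
    have e2 := h'.2.2 φ hφ hφs hφΩ
    have hz : ∀ x, x ∉ Ω → φ x = 0 := fun x hx =>
      image_eq_zero_of_notMem_tsupport fun h' => hx (hφΩ h')
    have i1 := integrable_mul_of_tsupport_subset hφ.continuous hφs hφΩ h.2.1
    have i2 := integrable_mul_of_tsupport_subset hφ.continuous hφs hφΩ h'.2.1
    rw [e1, neg_inj, setIntegral_eq_integral_of_forall_compl_eq_zero (fun x hx => by simp [hz x hx]),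
      setIntegral_eq_integral_of_forall_compl_eq_zero (fun x hx => by simp [hz x hx])] at e2
    simp only [smul_eq_mul, Pi.sub_apply, mul_sub]
    rw [integral_sub i1 i2]
    simp_rw [mul_comm (φ _)]
    rw [e2, sub_self]
  rw [EventuallyEq, ae_restrict_iff' hΩ.measurableSet]
  filter_upwards [h0] with x hx hxΩ
  exact sub_eq_zero.1 (hx hxΩ)

/-- A weak Hessian comes with its own first-order gradient, a priori unrelated to `G`. Uniqueness of
weak derivatives identifies them almost everywhere, so `H` may be differentiated from `G`. -/
theorem exists_measurable_representatives {Ω : Set (Euc n)} (hΩ : IsOpen Ω) {u : Euc n → ℝ}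
    {G : Euc n → Euc n} {H : Euc n → Matrix (Fin n) (Fin n) ℝ} (hG : IsWeakGradient Ω u G)
    (hH : IsWeakHessian Ω u H) :
    ∃ (G' : Euc n → Euc n) (H' : Euc n → Matrix (Fin n) (Fin n) ℝ),
      G =ᵐ[volume.restrict Ω] G' ∧ H =ᵐ[volume.restrict Ω] H' ∧
      (∀ i, Measurable fun x => G' x i) ∧ (∀ i j, Measurable fun x => H' x i j) ∧
      IsWeakGradient Ω u G' ∧
      ∀ i j, IsWeakPartial Ω (fun x => G' x i) (fun x => H' x i j) j := by
  obtain ⟨G₁, hG₁, hG₁H⟩ := hH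
  have hGm := fun i => (hG i).2.1.aestronglyMeasurable.aemeasurable
  have hHm := fun i j => (hG₁H i j).2.1.aestronglyMeasurable.aemeasurable
  have e1 : ∀ i, (fun x => G x i) =ᵐ[volume.restrict Ω] (hGm i).mk := fun i => (hGm i).ae_eq_mk
  have e2 : ∀ i j, (fun x => H x i j) =ᵐ[volume.restrict Ω] (hHm i j).mk :=
    fun i j => (hHm i j).ae_eq_mk
  have e3 : ∀ i, (fun x => G₁ x i) =ᵐ[volume.restrict Ω] (hGm i).mk :=
    fun i => ((hG₁ i).ae_eq hΩ (hG i)).trans (e1 i)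
  refine ⟨fun x => WithLp.toLp 2 fun i => (hGm i).mk _ x, fun x i j => (hHm i j).mk _ x,
    ?_, ?_, fun i => (hGm i).measurable_mk, fun i j => (hHm i j).measurable_mk,
    fun i => (hG i).congr (ae_eq_refl _) (e1 i), fun i j => (hG₁H i j).congr (e3 i) (e2 i j)⟩
  · filter_upwards [ae_all_iff.2 e1] with x hx
    ext i
    exact hx i
  · filter_upwards [ae_all_iff.2 fun i => ae_all_iff.2 (e2 i)] with x hx
    ext i j
    exact hx i j

/-! ### The gradient estimate -/

section Line

variable {Ω : Set (Euc n)} {u : Euc n → ℝ} {x θ : Euc n} {c M : ℝ}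

theorem tendsto_ray_zeta (hΩ : IsOpen Ω) (hu : ContinuousOn u (closure Ω)) (hx : x ∈ Ω)
    (hne : (hitTimes Ω x θ).Nonempty) :
    Tendsto (fun b : ℝ => u (x + b • θ)) (𝓝[<] sInf (hitTimes Ω x θ)) (𝓝 (u (zeta Ω x θ))) := by
  have hT := sInf_hitTimes_mem hΩ hx hne
  refine (hu _ (frontier_subset_closure hT.2)).tendsto.comp (tendsto_nhdsWithin_iff.2 ⟨?_, ?_⟩)
  · exact ((by fun_prop : Continuous fun b : ℝ => x + b • θ).tendsto _).mono_left
      nhdsWithin_le_nhds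
  · filter_upwards [Ioo_mem_nhdsLT hT.1] with b hb
    exact subset_closure (add_smul_mem_of_lt_sInf hΩ hx hb.1.le hb.2)

theorem abs_sub_sub_le_at_zeta (hΩ : IsOpen Ω) (hu : ContinuousOn u (closure Ω)) (hx : x ∈ Ω)
    (hD : ∀ b : ℝ, 0 < b → (∀ t ∈ Icc 0 b, x + t • θ ∈ Ω) →
      |u (x + b • θ) - u x - b * c| ≤ b * M) (hne : (hitTimes Ω x θ).Nonempty) :
    |u (zeta Ω x θ) - u x - sInf (hitTimes Ω x θ) * c| ≤ sInf (hitTimes Ω x θ) * M := by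
  have hT := sInf_hitTimes_mem hΩ hx hne
  have hid : Tendsto (fun b : ℝ => b) (𝓝[<] sInf (hitTimes Ω x θ))
    (𝓝 (sInf (hitTimes Ω x θ))) := nhdsWithin_le_nhds
  refine le_of_tendsto_of_tendsto (((tendsto_ray_zeta hΩ hu hx hne).sub_const (u x)).sub
    (hid.mul_const c)).abs (hid.mul_const M) ?_
  filter_upwards [Ioo_mem_nhdsLT hT.1] with b hb
  exact hD b hb.1 fun t ht => add_smul_mem_of_lt_sInf hΩ hx ht.1 (ht.2.trans_lt hb.2)

theorem exists_forall_ray_eq_zero (hb : Bornology.IsBounded {x ∈ closure Ω | u x ≠ 0})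
    (hθ : ‖θ‖ = 1) (x : Euc n) :
    ∃ B : ℝ, 0 < B ∧ ∀ b, B ≤ b → x + b • θ ∈ Ω → u (x + b • θ) = 0 := by
  obtain ⟨R, hR⟩ := hb.subset_closedBall 0
  refine ⟨|R| + ‖x‖ + 1, by positivity, fun b hb hbΩ => ?_⟩
  by_contra hne
  have h1 : ‖x + b • θ‖ ≤ R := by simpa using hR ⟨subset_closure hbΩ, hne⟩
  have hb0 : 0 ≤ b := le_trans (by positivity) hb
  have h2 : ‖b • θ‖ ≤ ‖x + b • θ‖ + ‖x‖ := by
    calc ‖b • θ‖ = ‖(x + b • θ) - x‖ := by simp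
      _ ≤ _ := norm_sub_le _ _
  rw [norm_smul, hθ, Real.norm_of_nonneg hb0, mul_one] at h2
  linarith [le_abs_self R]

/-- Far out on the ray `u` vanishes, so dividing the Taylor inequality by `b` leaves `|c| ≤ M + |u
x| / b`; then `b → ∞`. -/
theorem abs_le_of_hitTimes_eq_empty (hΩ : IsOpen Ω)
    (hb : Bornology.IsBounded {x ∈ closure Ω | u x ≠ 0}) (hx : x ∈ Ω) (hθ : ‖θ‖ = 1)
    (hD : ∀ b : ℝ, 0 < b → (∀ t ∈ Icc 0 b, x + t • θ ∈ Ω) →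
      |u (x + b • θ) - u x - b * c| ≤ b * M) (hne : ¬ (hitTimes Ω x θ).Nonempty) : |c| ≤ M := by
  obtain ⟨B, hB0, hB⟩ := exists_forall_ray_eq_zero hb hθ x
  have hmem : ∀ t : ℝ, 0 ≤ t → x + t • θ ∈ Ω := fun t ht =>
    add_smul_mem_of_hitTimes_eq_empty hΩ hx hne ht
  have h1 : ∀ b, B ≤ b → |c| ≤ M + |u x| * b⁻¹ := by
    intro b hbB
    have hb0 : 0 < b := hB0.trans_le hbB
    have h2 := hD b hb0 fun t ht => hmem t ht.1
    rw [hB b hbB (hmem b hb0.le)] at h2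
    have h3 : b * |c| ≤ b * M + |u x| := by
      calc b * |c| = |(-(0 - u x - b * c)) + (-u x)| := by
            rw [← abs_of_pos hb0, ← abs_mul, abs_of_pos hb0]; congr 1; ring
        _ ≤ |-(0 - u x - b * c)| + |-u x| := abs_add_le _ _
        _ ≤ _ := by rw [abs_neg, abs_neg]; gcongr
    have h4 : b * (M + |u x| * b⁻¹) = b * M + |u x| := by field_simp
    exact le_of_mul_le_mul_left (h3.trans h4.ge) hb0
  have h2 : Tendsto (fun b : ℝ => M + |u x| * b⁻¹) atTop (𝓝 (M + |u x| * 0)) :=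
    (tendsto_inv_atTop_zero.const_mul _).const_add _
  rw [mul_zero, add_zero] at h2
  exact ge_of_tendsto h2 (by filter_upwards [eventually_ge_atTop B] with b hb using h1 b hb)

/-- The core of the gradient estimate: subtracting the Taylor inequalities of opposite rays cancels
`u x` and leaves `(T + T') * c`. Positive parts keep the bound valid where `g` is negative,
including when only one ray reaches the boundary. -/
theorem abs_le_of_two_rays {M' : ℝ} {g : Euc n → ℝ} {N : Set (Euc n)} (hΩ : IsOpen Ω)
    (hu : MemCb Ω u) (hx : x ∈ Ω) (hθ : ‖θ‖ = 1) (hM : 0 ≤ M) (hM' : 0 ≤ M')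
    (hg : ∀ x ∈ frontier Ω \ N, ∀ y ∈ frontier Ω \ N, |u x - u y| ≤ ‖x - y‖ * (g x + g y))
    (hN : ∀ t : ℝ, 0 < t → x + t • θ ∉ N) (hN' : ∀ t : ℝ, 0 < t → x + t • (-θ) ∉ N)
    (hD : ∀ b : ℝ, 0 < b → (∀ t ∈ Icc 0 b, x + t • θ ∈ Ω) →
      |u (x + b • θ) - u x - b * c| ≤ b * M)
    (hD' : ∀ b : ℝ, 0 < b → (∀ t ∈ Icc 0 b, x + t • (-θ) ∈ Ω) →
      |u (x + b • (-θ)) - u x - b * (-c)| ≤ b * M') :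
    |c| ≤ M + M' + max (compZeta Ω g x θ) 0 + max (compZeta Ω g x (-θ)) 0 := by
  have hm := le_max_right (compZeta Ω g x θ) 0
  have hm' := le_max_right (compZeta Ω g x (-θ)) 0
  by_cases hne : (hitTimes Ω x θ).Nonempty
  swap
  · have := abs_le_of_hitTimes_eq_empty hΩ hu.2 hx hθ hD hne
    linarith
  by_cases hne' : (hitTimes Ω x (-θ)).Nonempty
  swap
  · have := abs_le_of_hitTimes_eq_empty hΩ hu.2 hx (by rwa [norm_neg]) hD' hne'
    rw [abs_neg] at this
    linarith
  have hT := sInf_hitTimes_mem hΩ hx hne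
  have hT' := sInf_hitTimes_mem hΩ hx hne'
  have h1 := abs_sub_sub_le_at_zeta hΩ hu.1 hx hD hne
  have h2 := abs_sub_sub_le_at_zeta hΩ hu.1 hx hD' hne'
  have h3 := hg (zeta Ω x θ) ⟨hT.2, hN _ hT.1⟩ (zeta Ω x (-θ)) ⟨hT'.2, hN' _ hT'.1⟩
  -- Both boundary points lie on one line, on opposite sides of `x`: the distance in the Hajłasz
  -- inequality is exactly the coefficient of `c`.
  have h4 : ‖zeta Ω x θ - zeta Ω x (-θ)‖ =
      sInf (hitTimes Ω x θ) + sInf (hitTimes Ω x (-θ)) := by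
    have : zeta Ω x θ - zeta Ω x (-θ) =
        (sInf (hitTimes Ω x θ) + sInf (hitTimes Ω x (-θ))) • θ := by
      simp only [zeta]; module
    rw [this, norm_smul, hθ, mul_one, Real.norm_of_nonneg (add_nonneg hT.1.le hT'.1.le)]
  rw [h4] at h3
  have hc1 : compZeta Ω g x θ = g (zeta Ω x θ) := if_pos hne
  have hc2 : compZeta Ω g x (-θ) = g (zeta Ω x (-θ)) := if_pos hne'
  rw [← hc1, ← hc2] at h3
  have hg1 := le_max_left (compZeta Ω g x θ) 0
  have hg2 := le_max_left (compZeta Ω g x (-θ)) 0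
  have hT0 := hT.1
  have hT0' := hT'.1
  generalize sInf (hitTimes Ω x θ) = T at *
  generalize sInf (hitTimes Ω x (-θ)) = T' at *
  generalize max (compZeta Ω g x θ) 0 = a at *
  generalize max (compZeta Ω g x (-θ)) 0 = a' at *
  have hTT : 0 < T + T' := add_pos hT0 hT0'
  have h5 : (T + T') * (compZeta Ω g x θ + compZeta Ω g x (-θ)) ≤ (T + T') * (a + a') := by
    gcongr
  have h6 : T * M ≤ (T + T') * M := by nlinarith
  have h7 : T' * M' ≤ (T + T') * M' := by nlinarith
  refine le_of_mul_le_mul_left ?_ hTT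
  have h8 : (T + T') * |c| = |(T + T') * c| := by rw [abs_mul, abs_of_pos hTT]
  rw [h8]
  rw [abs_le] at h1 h2 h3 ⊢
  constructor <;> linarith [h1.1, h1.2, h2.1, h2.2, h3.1, h3.2]

end Line

theorem measurable_matrixAbs {H : Euc n → Matrix (Fin n) (Fin n) ℝ}
    (hHm : ∀ i j, Measurable fun x => H x i j) : Measurable fun x => matrixAbs (H x) := by
  unfold matrixAbs
  exact (Finset.measurable_sum _ fun i _ => Finset.measurable_sum _ fun j _ =>
    (hHm i j).pow_const 2).sqrt

theorem ofReal_max_zero (a : ℝ) : ENNReal.ofReal (max a 0) = ENNReal.ofReal a := by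
  rw [ENNReal.ofReal_max]; simp

/-- The gradient estimate, before integrating over directions. -/
theorem ae_ae_ofReal_inner_le (hn : 2 ≤ n) {Ω : Set (Euc n)} (hΩ : IsOpen Ω) {u g : Euc n → ℝ}
    {G : Euc n → Euc n} {H : Euc n → Matrix (Fin n) (Fin n) ℝ} (hu : MemCb Ω u)
    (hGm : ∀ i, Measurable fun x => G x i) (hHm : ∀ i j, Measurable fun x => H x i j)
    (hG : IsWeakGradient Ω u G)
    (hH : ∀ i j, IsWeakPartial Ω (fun x => G x i) (fun x => H x i j) j)
    (hg : IsHajlaszGradient Ω u g) :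
    ∀ᵐ x, x ∈ Ω → ∀ᵐ θ ∂sphereMeasure n, ENNReal.ofReal |inner ℝ (G x) θ| ≤
      ((∫⁻ t in Ioi (0 : ℝ), Ω.indicator (fun y => ENNReal.ofReal (matrixAbs (H y))) (x + t • θ)) +
      ∫⁻ t in Ioi (0 : ℝ),
        Ω.indicator (fun y => ENNReal.ofReal (matrixAbs (H y))) (x + t • (-θ))) +
      (ENNReal.ofReal (compZeta Ω g x θ) + ENNReal.ofReal (compZeta Ω g x (-θ))) := by
  obtain ⟨-, N, hNΩ, hN, hgN⟩ := hg
  filter_upwards [ae_ae_ray_sub_le (by omega) hΩ (hu.1.mono subset_closure) hGm hHm hG hH]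
    with x hx hxΩ
  obtain ⟨r, hr, hrΩ⟩ := Metric.isOpen_iff.1 hΩ x hxΩ
  have hNr : ∀ y ∈ N, r ≤ ‖y - x‖ := by
    intro y hy
    by_contra hlt
    exact notMem_frontier_of_mem hΩ (hrΩ (by rw [mem_ball, dist_eq_norm]; linarith)) (hNΩ hy)
  have hNae := ae_add_smul_notMem_of_hausdorffMeasure_null hn hN hr hNr
  filter_upwards [hx, ae_neg_sphereMeasure hx, hNae, ae_neg_sphereMeasure hNae,
    ae_sphereMeasure_norm_eq_one] with θ h1 h2 h3 h4 hθ
  set h : Euc n → ℝ≥0∞ := Ω.indicator (fun y => ENNReal.ofReal (matrixAbs (H y))) with hh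
  have hseg : ∀ (ϑ : Euc n) (b : ℝ), (∀ t ∈ Icc 0 b, x + t • ϑ ∈ Ω) →
      ∫⁻ t in Ioc 0 b, ENNReal.ofReal (matrixAbs (H (x + t • ϑ))) ≤
        ∫⁻ t in Ioi (0 : ℝ), h (x + t • ϑ) := by
    intro ϑ b hb
    calc ∫⁻ t in Ioc 0 b, ENNReal.ofReal (matrixAbs (H (x + t • ϑ)))
        = ∫⁻ t in Ioc 0 b, h (x + t • ϑ) := by
          refine setLIntegral_congr_fun measurableSet_Ioc fun t ht => ?_
          simp only [hh, indicator_of_mem (hb t ⟨ht.1.le, ht.2⟩)]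
      _ ≤ _ := lintegral_mono_set Ioc_subset_Ioi_self
  have hreal : ∀ (ϑ : Euc n) (c : ℝ), (∫⁻ t in Ioi (0 : ℝ), h (x + t • ϑ)) ≠ ⊤ →
      (∀ b : ℝ, 0 < b → (∀ t ∈ Icc 0 b, x + t • ϑ ∈ Ω) →
        ‖u (x + b • ϑ) - u x - b * c‖ₑ ≤
        ENNReal.ofReal b * ∫⁻ t in Ioc 0 b, ENNReal.ofReal (matrixAbs (H (x + t • ϑ)))) →
      ∀ b : ℝ, 0 < b → (∀ t ∈ Icc 0 b, x + t • ϑ ∈ Ω) →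
        |u (x + b • ϑ) - u x - b * c| ≤ b * (∫⁻ t in Ioi (0 : ℝ), h (x + t • ϑ)).toReal := by
    intro ϑ c hfin hϑ b hb hbΩ
    have h5 := (hϑ b hb hbΩ).trans (mul_le_mul' le_rfl (hseg ϑ b hbΩ))
    rw [← ENNReal.ofReal_toReal hfin, ← ENNReal.ofReal_mul hb.le, ← ofReal_norm,
      ENNReal.ofReal_le_ofReal_iff (by positivity)] at h5
    exact h5
  -- With an infinite ray integral the claim is trivial; otherwise the argument continues in real
  -- numbers.
  by_cases hf1 : (∫⁻ t in Ioi (0 : ℝ), h (x + t • θ)) = ⊤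
  · rw [hf1]; simp
  by_cases hf2 : (∫⁻ t in Ioi (0 : ℝ), h (x + t • (-θ))) = ⊤
  · rw [hf2]; simp
  have key := abs_le_of_two_rays (c := inner ℝ (G x) θ) hΩ hu hxΩ hθ ENNReal.toReal_nonneg
    ENNReal.toReal_nonneg hgN h3 h4 (hreal θ _ hf1 h1) (hreal (-θ) (-inner ℝ (G x) θ) hf2
      (by simpa only [inner_neg_right] using h2))
  refine (ENNReal.ofReal_le_ofReal key).trans (le_of_eq ?_)
  rw [add_assoc, ENNReal.ofReal_add (by positivity) (by positivity),
    ENNReal.ofReal_add (by positivity) (by positivity),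
    ENNReal.ofReal_add (by positivity) (by positivity), ENNReal.ofReal_toReal hf1,
    ENNReal.ofReal_toReal hf2, ofReal_max_zero, ofReal_max_zero]

/-- The gradient estimate with the cone measure on the sphere. -/
theorem exists_gradient_estimate (hn : 2 ≤ n) : ∃ C : ℝ, 0 < C ∧
    ∀ (Ω : Set (Euc n)), IsOpen Ω → ∀ (u g : Euc n → ℝ) (G : Euc n → Euc n)
      (H : Euc n → Matrix (Fin n) (Fin n) ℝ), MemCb Ω u →
      (∀ i, Measurable fun x => G x i) → (∀ i j, Measurable fun x => H x i j) →
      IsWeakGradient Ω u G →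
      (∀ i j, IsWeakPartial Ω (fun x => G x i) (fun x => H x i j) j) →
      IsHajlaszGradient Ω u g →
      ∀ᵐ x, x ∈ Ω → ENNReal.ofReal ‖G x‖ ≤ ENNReal.ofReal C *
        ((∫⁻ y, Ω.indicator (fun y => ENNReal.ofReal (matrixAbs (H y))) y * rieszKernel x y) +
          ∫⁻ θ, ENNReal.ofReal (compZeta Ω g x θ) ∂sphereMeasure n) := by
  obtain ⟨c, hc, hcv⟩ := norm_smul_le_lintegral_inner (n := n) (by omega)
  refine ⟨2 / c, by positivity, fun Ω hΩ u g G H hu hGm hHm hG hH hg => ?_⟩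
  filter_upwards [ae_ae_ofReal_inner_le hn hΩ hu hGm hHm hG hH hg] with x hx hxΩ
  set h : Euc n → ℝ≥0∞ := Ω.indicator (fun y => ENNReal.ofReal (matrixAbs (H y))) with hh
  have hhm : Measurable h := (measurable_matrixAbs hHm).ennreal_ofReal.indicator hΩ.measurableSet
  have hm1 : Measurable fun θ : Euc n => ∫⁻ t in Ioi (0 : ℝ), h (x + t • θ) :=
    Measurable.lintegral_prod_right' (f := fun p : Euc n × ℝ => h (x + p.2 • p.1))
      (hhm.comp (by fun_prop))
  have hm2 : Measurable fun θ => ENNReal.ofReal (compZeta Ω g x θ) :=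
    (measurable_compZeta hΩ hxΩ hg.1).ennreal_ofReal
  have hm1' : Measurable fun θ : Euc n =>
      (∫⁻ t in Ioi (0 : ℝ), h (x + t • θ)) + ∫⁻ t in Ioi (0 : ℝ), h (x + t • (-θ)) :=
    hm1.add (hm1.comp measurable_neg)
  set A := ∫⁻ y, h y * rieszKernel x y with hA
  set B := ∫⁻ θ, ENNReal.ofReal (compZeta Ω g x θ) ∂sphereMeasure n with hB
  have hA' : A = ∫⁻ θ, (∫⁻ t in Ioi (0 : ℝ), h (x + t • θ)) ∂sphereMeasure n :=
    lintegral_mul_rieszKernel (by omega) hhm x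
  -- By symmetry of the sphere the `-θ` terms equal the `θ` terms, which is the origin of the factor
  -- `2` in `2 / c`.
  have key : ENNReal.ofReal (c * ‖G x‖) ≤ (A + A) + (B + B) := by
    refine (hcv (G x)).trans ((lintegral_mono_ae (hx hxΩ)).trans (le_of_eq ?_))
    rw [lintegral_add_left hm1', lintegral_add_left hm1,
      lintegral_add_left hm2,
      lintegral_neg_sphereMeasure (fun θ => ∫⁻ t in Ioi (0 : ℝ), h (x + t • θ)),
      lintegral_neg_sphereMeasure (fun θ => ENNReal.ofReal (compZeta Ω g x θ)), ← hA']
  calc ENNReal.ofReal ‖G x‖ = ENNReal.ofReal (1 / c) * ENNReal.ofReal (c * ‖G x‖) := by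
        rw [← ENNReal.ofReal_mul (by positivity)]; congr 1; field_simp
    _ ≤ ENNReal.ofReal (1 / c) * ((A + A) + (B + B)) := by gcongr
    _ = ENNReal.ofReal (2 / c) * (A + B) := by
        rw [show 2 / c = 1 / c * 2 by ring, ENNReal.ofReal_mul (p := 1 / c) (by positivity)]
        simp only [ENNReal.ofReal_ofNat]
        ring

/-! ### Composition of Riesz kernels -/

/-- With `n = m + 3`, the factor `1 / t ^ m` is at most `1 / r ^ m` and the remaining `t ^ (-2)`
integrates to `1 / r`. For `n = 2` the integral would diverge logarithmically. -/
theorem lintegral_Ioi_one_div_pow_le (hn : 3 ≤ n) {r : ℝ} (hr : 0 < r) :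
    ∫⁻ t in Ioi r, ENNReal.ofReal (1 / t ^ (n - 1)) ≤ ENNReal.ofReal (1 / r ^ (n - 2)) := by
  obtain ⟨m, rfl⟩ : ∃ m, n = m + 3 := ⟨n - 3, by omega⟩
  have h1 : ∫⁻ t in Ioi r, ENNReal.ofReal (t ^ (-2 : ℝ)) = ENNReal.ofReal r⁻¹ := by
    rw [← ofReal_integral_eq_lintegral_ofReal (integrableOn_Ioi_rpow_of_lt (by norm_num) hr),
      integral_Ioi_rpow_of_lt (by norm_num) hr]
    · norm_num [Real.rpow_neg_one]
    · filter_upwards [ae_restrict_mem measurableSet_Ioi] with t ht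
      exact Real.rpow_nonneg (hr.le.trans (le_of_lt ht)) _
  calc ∫⁻ t in Ioi r, ENNReal.ofReal (1 / t ^ (m + 3 - 1))
      ≤ ∫⁻ t in Ioi r, ENNReal.ofReal (1 / r ^ m) * ENNReal.ofReal (t ^ (-2 : ℝ)) := by
        refine setLIntegral_mono' measurableSet_Ioi fun t (ht : r < t) => ?_
        have ht0 : 0 < t := hr.trans ht
        rw [← ENNReal.ofReal_mul (by positivity)]
        refine ENNReal.ofReal_le_ofReal ?_
        rw [Real.rpow_neg ht0.le, Real.rpow_ofNat, ← one_div, one_div_mul_one_div,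
          show m + 3 - 1 = m + 2 by omega, pow_add]
        gcongr
    _ = ENNReal.ofReal (1 / r ^ (m + 3 - 2)) := by
        rw [lintegral_const_mul' _ _ ENNReal.ofReal_ne_top, h1, ← ENNReal.ofReal_mul (by positivity),
          show m + 3 - 2 = m + 1 by omega, pow_succ]
        congr 1
        field_simp

theorem lintegral_rieszKernel_sq_le (hn : 3 ≤ n) (x : Euc n) {r : ℝ} (hr : 0 < r) :
    ∫⁻ y, (ball x r)ᶜ.indicator (fun y => rieszKernel x y) y * rieszKernel x y ≤
      ENNReal.ofReal (1 / r ^ (n - 2)) * sphereMeasure n univ := by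
  have hm : Measurable ((ball x r)ᶜ.indicator fun y => rieszKernel x y) :=
    Measurable.indicator (by unfold rieszKernel; fun_prop) measurableSet_ball.compl
  rw [lintegral_mul_rieszKernel (by omega) hm, ← lintegral_const]
  refine lintegral_mono_ae ?_
  filter_upwards [ae_sphereMeasure_norm_eq_one] with θ hθ
  calc ∫⁻ t in Ioi (0 : ℝ), (ball x r)ᶜ.indicator (fun y => rieszKernel x y) (x + t • θ)
      = ∫⁻ t in Ioi (0 : ℝ),
          (Ici r).indicator (fun t => ENNReal.ofReal (1 / t ^ (n - 1))) t := by
        refine setLIntegral_congr_fun measurableSet_Ioi fun t (ht : 0 < t) => ?_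
        have hnt : ‖x - (x + t • θ)‖ = t := by simp [norm_smul, hθ, abs_of_pos ht]
        have hiff : x + t • θ ∈ (ball x r)ᶜ ↔ t ∈ Ici r := by
          rw [mem_compl_iff, mem_ball, dist_comm, dist_eq_norm, hnt, not_lt, mem_Ici]
        by_cases h : t ∈ Ici r
        · simp only [indicator_of_mem h, indicator_of_mem (hiff.2 h), rieszKernel, hnt]
        · simp only [indicator_of_notMem h, indicator_of_notMem (fun h' => h (hiff.1 h'))]
    _ ≤ ∫⁻ t, (Ici r).indicator (fun t => ENNReal.ofReal (1 / t ^ (n - 1))) t :=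
        setLIntegral_le_lintegral _ _
    _ = ∫⁻ t in Ioi r, ENNReal.ofReal (1 / t ^ (n - 1)) := by
        rw [lintegral_indicator measurableSet_Ici, restrict_Ioi_eq_restrict_Ici]
    _ ≤ _ := lintegral_Ioi_one_div_pow_le hn hr

/-- With `r` half the distance of `x` and `z`: near either point the other kernel is at most `r ^ (1
- n)` and the singular one integrates to a multiple of `r`. Away from both, the product is at most
the sum of the squares. Each of the four pieces is at most a multiple of `r ^ (2 - n)`. -/
theorem exists_lintegral_rieszKernel_mul_le (hn : 3 ≤ n) : ∃ C : ℝ, 0 < C ∧ ∀ x z : Euc n, x ≠ z →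
    ∫⁻ y, rieszKernel x y * rieszKernel y z ≤
      ENNReal.ofReal C * ENNReal.ofReal (1 / ‖x - z‖ ^ (n - 2)) := by
  set S := sphereMeasure n univ with hS
  have hStop : S ≠ ⊤ := measure_ne_top _ _
  have hS0 : S ≠ 0 := sphereMeasure_univ_ne_zero (by omega)
  have hSpos : 0 < S.toReal := ENNReal.toReal_pos hS0 hStop
  refine ⟨4 * S.toReal * 2 ^ (n - 2), by positivity, fun x z hxz => ?_⟩
  have hd : 0 < ‖x - z‖ := norm_pos_iff.2 (sub_ne_zero.2 hxz)
  set r := ‖x - z‖ / 2 with hr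
  have hr0 : 0 < r := by positivity
  have htri : ∀ y, 2 * r ≤ ‖x - y‖ + ‖y - z‖ := fun y => by
    rw [hr, mul_div_cancel₀ _ two_ne_zero]; exact norm_sub_le_norm_sub_add_norm_sub x y z
  set c := ENNReal.ofReal (1 / r ^ (n - 1)) with hc
  have hk : ∀ w : Euc n, Measurable fun y => rieszKernel w y := fun w => by
    unfold rieszKernel; fun_prop
  have hm1 : ∀ w : Euc n, Measurable ((ball w r).indicator fun y => rieszKernel w y) :=
    fun w => (hk w).indicator measurableSet_ball
  have hm2 : ∀ w : Euc n, Measurable fun y =>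
      (ball w r)ᶜ.indicator (fun y => rieszKernel w y) y * rieszKernel w y :=
    fun w => ((hk w).indicator measurableSet_ball.compl).mul (hk w)
  have hpt : ∀ y, rieszKernel x y * rieszKernel y z ≤
      ((ball x r).indicator (fun y => rieszKernel x y) y * c +
        (ball z r).indicator (fun y => rieszKernel z y) y * c) +
      ((ball x r)ᶜ.indicator (fun y => rieszKernel x y) y * rieszKernel x y +
        (ball z r)ᶜ.indicator (fun y => rieszKernel z y) y * rieszKernel z y) := by
    intro y
    rw [rieszKernel_comm y z]
    by_cases hx : y ∈ ball x r
    · have h1 : ‖x - y‖ < r := by rw [← dist_eq_norm, dist_comm]; exact hx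
      rw [indicator_of_mem hx]
      refine le_trans ?_ (le_self_add.trans le_self_add)
      gcongr
      refine rieszKernel_le_of_le hr0 ?_
      rw [norm_sub_rev]; linarith [htri y]
    by_cases hz : y ∈ ball z r
    · have h1 : ‖y - z‖ < r := by rw [← dist_eq_norm]; exact hz
      rw [indicator_of_mem hz]
      refine le_trans ?_ (le_add_self.trans le_self_add)
      rw [mul_comm]
      gcongr
      refine rieszKernel_le_of_le hr0 ?_
      linarith [htri y]
    · rw [indicator_of_mem (show y ∈ (ball x r)ᶜ from hx),
        indicator_of_mem (show y ∈ (ball z r)ᶜ from hz)]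
      refine le_trans ?_ le_add_self
      rcases le_total (rieszKernel x y) (rieszKernel z y) with h | h
      · exact (mul_le_mul' h le_rfl).trans le_add_self
      · exact (mul_le_mul' le_rfl h).trans le_self_add
  have hball : ∀ w : Euc n, ∫⁻ y, (ball w r).indicator (fun y => rieszKernel w y) y * c =
      ENNReal.ofReal (1 / r ^ (n - 2)) * S := by
    intro w
    rw [lintegral_mul_const _ (hm1 w), lintegral_indicator measurableSet_ball,
      lintegral_ball_rieszKernel (by omega), hc, mul_right_comm, ← ENNReal.ofReal_mul hr0.le]
    congr 2
    rw [show n - 1 = n - 2 + 1 by omega, pow_succ]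
    field_simp
  calc ∫⁻ y, rieszKernel x y * rieszKernel y z
      ≤ (ENNReal.ofReal (1 / r ^ (n - 2)) * S + ENNReal.ofReal (1 / r ^ (n - 2)) * S) +
        (ENNReal.ofReal (1 / r ^ (n - 2)) * S + ENNReal.ofReal (1 / r ^ (n - 2)) * S) := by
        refine (lintegral_mono hpt).trans ?_
        have hm3 : Measurable fun y =>
            (ball x r)ᶜ.indicator (fun y => rieszKernel x y) y * rieszKernel x y +
            (ball z r)ᶜ.indicator (fun y => rieszKernel z y) y * rieszKernel z y :=
          (hm2 x).add (hm2 z)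
        rw [lintegral_add_right _ hm3, lintegral_add_right _ (hm2 z),
          lintegral_add_left ((hm1 x).mul_const c), hball, hball]
        gcongr
        · exact lintegral_rieszKernel_sq_le hn x hr0
        · exact lintegral_rieszKernel_sq_le hn z hr0
    _ = 4 * (S * ENNReal.ofReal (1 / r ^ (n - 2))) := by ring
    _ = _ := by
        rw [← ENNReal.ofReal_toReal hStop, ← ENNReal.ofReal_mul (by positivity),
          ← ENNReal.ofReal_mul (by positivity),
          show (4 : ℝ≥0∞) = ENNReal.ofReal 4 by simp, ← ENNReal.ofReal_mul (by norm_num), hr,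
          ENNReal.toReal_ofReal (by positivity)]
        congr 1
        rw [div_pow]
        field_simp

/-! ### The estimate for the function -/

section Pointwise

variable {Ω : Set (Euc n)} {u : Euc n → ℝ} {G : Euc n → Euc n}
  {H : Euc n → Matrix (Fin n) (Fin n) ℝ}

/-- The first-order ray inequality is carried up to the first boundary point by continuity. If there
is none, it is used at a point where `u` vanishes, in accordance with the zero convention of
`compZeta`. -/
theorem ae_enorm_le_compZeta_add (hn : 0 < n) (hΩ : IsOpen Ω) (hu : MemCb Ω u)
    (hGm : ∀ i, Measurable fun x => G x i) (hHm : ∀ i j, Measurable fun x => H x i j)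
    (hG : IsWeakGradient Ω u G)
    (hH : ∀ i j, IsWeakPartial Ω (fun x => G x i) (fun x => H x i j) j) {x : Euc n}
    (hx : x ∈ Ω) : ∀ᵐ θ ∂sphereMeasure n, ‖u x‖ₑ ≤ ENNReal.ofReal |compZeta Ω u x θ| +
      ∫⁻ t in Ioi (0 : ℝ), Ω.indicator (fun y => ‖G y‖ₑ) (x + t • θ) := by
  filter_upwards [ae_ray_le hn hΩ (hu.1.mono subset_closure) hGm hHm hG hH x,
    ae_sphereMeasure_norm_eq_one] with θ hθ hθ1
  have hD : ∀ b : ℝ, 0 < b → (∀ t ∈ Icc 0 b, x + t • θ ∈ Ω) → ‖u (x + b • θ) - u x‖ₑ ≤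
      ∫⁻ t in Ioi (0 : ℝ), Ω.indicator (fun y => ‖G y‖ₑ) (x + t • θ) := by
    intro b hb hbΩ
    refine (hθ b hb hbΩ).trans ?_
    calc ∫⁻ t in Ioc 0 b, ‖G (x + t • θ)‖ₑ
        = ∫⁻ t in Ioc 0 b, Ω.indicator (fun y => ‖G y‖ₑ) (x + t • θ) := by
          refine setLIntegral_congr_fun measurableSet_Ioc fun t ht => ?_
          simp only [indicator_of_mem (hbΩ t ⟨ht.1.le, ht.2⟩)]
      _ ≤ _ := lintegral_mono_set Ioc_subset_Ioi_self
  have hsub : ∀ a : ℝ, ‖u x‖ₑ ≤ ‖a‖ₑ + ‖a - u x‖ₑ := fun a => by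
    have h := enorm_sub_le (a := a) (b := a - u x)
    rwa [sub_sub_cancel] at h
  by_cases hne : (hitTimes Ω x θ).Nonempty
  · have hT := sInf_hitTimes_mem hΩ hx hne
    have h1 := ((tendsto_ray_zeta hΩ hu.1 hx hne).sub_const (u x)).enorm
    have h2 : ‖u (zeta Ω x θ) - u x‖ₑ ≤
        ∫⁻ t in Ioi (0 : ℝ), Ω.indicator (fun y => ‖G y‖ₑ) (x + t • θ) := by
      refine le_of_tendsto h1 ?_
      filter_upwards [Ioo_mem_nhdsLT hT.1] with b hb
      exact hD b hb.1 fun t ht => add_smul_mem_of_lt_sInf hΩ hx ht.1 (ht.2.trans_lt hb.2)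
    rw [show compZeta Ω u x θ = u (zeta Ω x θ) from if_pos hne, ← Real.norm_eq_abs, ofReal_norm]
    exact (hsub (u (zeta Ω x θ))).trans (by gcongr)
  · obtain ⟨B, hB0, hB⟩ := exists_forall_ray_eq_zero hu.2 hθ1 x
    have hmem : ∀ t : ℝ, 0 ≤ t → x + t • θ ∈ Ω := fun t ht =>
      add_smul_mem_of_hitTimes_eq_empty hΩ hx hne ht
    have h1 := hD B hB0 fun t ht => hmem t ht.1
    rw [hB B le_rfl (hmem B hB0.le), zero_sub, enorm_neg] at h1
    exact h1.trans le_add_self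

theorem measurable_of_apply (hGm : ∀ i, Measurable fun x => G x i) : Measurable G := by
  have h : G = fun x => WithLp.toLp 2 fun i => G x i := rfl
  rw [h]
  exact (WithLp.measurable_toLp 2 _).comp (measurable_pi_lambda _ hGm)

theorem sphereMeasure_mul_enorm_le (hn : 0 < n) (hΩ : IsOpen Ω) (hu : MemCb Ω u)
    (hGm : ∀ i, Measurable fun x => G x i) (hHm : ∀ i j, Measurable fun x => H x i j)
    (hG : IsWeakGradient Ω u G)
    (hH : ∀ i j, IsWeakPartial Ω (fun x => G x i) (fun x => H x i j) j) {x : Euc n}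
    (hx : x ∈ Ω) : sphereMeasure n univ * ‖u x‖ₑ ≤
      (∫⁻ θ, ENNReal.ofReal |compZeta Ω u x θ| ∂sphereMeasure n) +
      ∫⁻ y in Ω, ‖G y‖ₑ * rieszKernel x y := by
  have hum : Measurable fun y : frontier Ω => u y :=
    (continuousOn_iff_continuous_domRestrict.1 (hu.1.mono frontier_subset_closure)).measurable
  have hm1 : Measurable fun θ => ENNReal.ofReal |compZeta Ω u x θ| :=
    (measurable_compZeta hΩ hx hum).abs.ennreal_ofReal
  have hGi : Measurable (Ω.indicator fun y => ‖G y‖ₑ) :=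
    (measurable_of_apply hGm).enorm.indicator hΩ.measurableSet
  calc sphereMeasure n univ * ‖u x‖ₑ = ∫⁻ _, ‖u x‖ₑ ∂sphereMeasure n := by
        rw [lintegral_const, mul_comm]
    _ ≤ _ := lintegral_mono_ae (ae_enorm_le_compZeta_add hn hΩ hu hGm hHm hG hH hx)
    _ = _ := by
        rw [lintegral_add_left hm1, ← lintegral_mul_rieszKernel hn hGi,
          ← lintegral_indicator hΩ.measurableSet]
        congr 2
        ext y
        by_cases hy : y ∈ Ω <;> simp [hy]

/-- The estimate for the function with the cone measure on the sphere. -/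
theorem exists_pointwise_estimate (hn : 3 ≤ n) : ∃ C : ℝ, 0 < C ∧
    ∀ (Ω : Set (Euc n)), IsOpen Ω → ∀ (u g : Euc n → ℝ) (G : Euc n → Euc n)
      (H : Euc n → Matrix (Fin n) (Fin n) ℝ), MemCb Ω u →
      (∀ i, Measurable fun x => G x i) → (∀ i j, Measurable fun x => H x i j) →
      IsWeakGradient Ω u G →
      (∀ i j, IsWeakPartial Ω (fun x => G x i) (fun x => H x i j) j) →
      IsHajlaszGradient Ω u g → ∀ x ∈ Ω,
      ENNReal.ofReal |u x| ≤ ENNReal.ofReal C *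
        ((∫⁻ y in Ω, ENNReal.ofReal (matrixAbs (H y) / ‖x - y‖ ^ (n - 2))) +
          (∫⁻ y in Ω, ∫⁻ θ, ENNReal.ofReal (compZeta Ω g y θ / ‖x - y‖ ^ (n - 1))
            ∂sphereMeasure n) +
          ∫⁻ θ, ENNReal.ofReal |compZeta Ω u x θ| ∂sphereMeasure n) := by
  obtain ⟨C₁, hC₁, hgrad⟩ := exists_gradient_estimate (n := n) (by omega)
  obtain ⟨C₂, hC₂, hcomp⟩ := exists_lintegral_rieszKernel_mul_le hn
  set S := sphereMeasure n univ with hS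
  have hStop : S ≠ ⊤ := measure_ne_top _ _
  have hS0 : S ≠ 0 := sphereMeasure_univ_ne_zero (by omega)
  have hSpos : 0 < S.toReal := ENNReal.toReal_pos hS0 hStop
  -- The three summands are the coefficients of `I₁`, `I₂` and `I₃`; `S` is the total mass over
  -- which `|u x|` was averaged.
  refine ⟨(C₁ * C₂ + C₁ + 1) / S.toReal, by positivity,
    fun Ω hΩ u g G H hu hGm hHm hG hH hg x hx => ?_⟩
  set h : Euc n → ℝ≥0∞ := Ω.indicator (fun y => ENNReal.ofReal (matrixAbs (H y))) with hh
  have hhm : Measurable h := (measurable_matrixAbs hHm).ennreal_ofReal.indicator hΩ.measurableSet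
  set I₁ := ∫⁻ y in Ω, ENNReal.ofReal (matrixAbs (H y) / ‖x - y‖ ^ (n - 2)) with hI₁
  set I₂ := ∫⁻ y in Ω, (∫⁻ θ, ENNReal.ofReal (compZeta Ω g y θ / ‖x - y‖ ^ (n - 1))
    ∂sphereMeasure n) with hI₂
  set I₃ := ∫⁻ θ, ENNReal.ofReal |compZeta Ω u x θ| ∂sphereMeasure n with hI₃
  have hk : Measurable fun p : Euc n × Euc n => h p.2 * rieszKernel p.1 p.2 := by fun_prop
  have hA : Measurable fun y => ∫⁻ z, h z * rieszKernel y z :=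
    Measurable.lintegral_prod_right' hk
  have hkx : Measurable fun y => rieszKernel x y := by unfold rieszKernel; fun_prop
  have hkr : ∀ z : Euc n, Measurable fun y => rieszKernel y z := fun z => by
    unfold rieszKernel; fun_prop
  have hhk : ∀ y : Euc n, Measurable fun z => h z * rieszKernel y z := fun y =>
    hhm.mul (by unfold rieszKernel; fun_prop)
  have hkk : ∀ z : Euc n, Measurable fun y => rieszKernel x y * rieszKernel y z :=
    fun z => hkx.mul (hkr z)
  have hAk : Measurable fun y => (∫⁻ z, h z * rieszKernel y z) * rieszKernel x y := hA.mul hkx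
  have e1 : ∫⁻ y in Ω, (∫⁻ z, h z * rieszKernel y z) * rieszKernel x y ≤
      ENNReal.ofReal C₂ * I₁ := by
    calc ∫⁻ y in Ω, (∫⁻ z, h z * rieszKernel y z) * rieszKernel x y
        ≤ ∫⁻ y, (∫⁻ z, h z * rieszKernel y z) * rieszKernel x y := setLIntegral_le_lintegral _ _
      _ = ∫⁻ y, ∫⁻ z, h z * (rieszKernel x y * rieszKernel y z) := by
          refine lintegral_congr fun y => ?_
          rw [← lintegral_mul_const _ (hhk y)]
          exact lintegral_congr fun z => by ring
      _ = ∫⁻ z, ∫⁻ y, h z * (rieszKernel x y * rieszKernel y z) := by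
          refine lintegral_lintegral_swap (Measurable.aemeasurable ?_)
          exact (hhm.comp measurable_snd).mul
            ((hkx.comp measurable_fst).mul measurable_rieszKernel)
      _ ≤ ∫⁻ z, h z * (ENNReal.ofReal C₂ * ENNReal.ofReal (1 / ‖x - z‖ ^ (n - 2))) := by
          have : Nonempty (Fin n) := ⟨⟨0, by omega⟩⟩
          have hne : ∀ᵐ z : Euc n, z ≠ x := Measure.ae_ne volume x
          refine lintegral_mono_ae ?_
          filter_upwards [hne] with z hz
          rw [lintegral_const_mul _ (hkk z)]
          gcongr
          exact hcomp x z hz.symm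
      _ = ENNReal.ofReal C₂ * I₁ := by
          rw [hI₁, ← lintegral_indicator hΩ.measurableSet,
            ← lintegral_const_mul' _ _ ENNReal.ofReal_ne_top]
          refine lintegral_congr fun z => ?_
          by_cases hz : z ∈ Ω
          · rw [hh, indicator_of_mem hz, indicator_of_mem hz, mul_left_comm,
              ← ENNReal.ofReal_mul (p := matrixAbs (H z)) (Real.sqrt_nonneg _), mul_one_div]
          · rw [hh, indicator_of_notMem hz, indicator_of_notMem hz, zero_mul, mul_zero]
  have e2 : ∫⁻ y in Ω, (∫⁻ θ, ENNReal.ofReal (compZeta Ω g y θ) ∂sphereMeasure n) *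
      rieszKernel x y = I₂ := by
    refine lintegral_congr fun y => ?_
    rw [rieszKernel, ← lintegral_mul_const' _ _ ENNReal.ofReal_ne_top]
    refine lintegral_congr fun θ => ?_
    rw [← ENNReal.ofReal_mul' (by positivity), mul_one_div]
  have e3 : ∫⁻ y in Ω, ‖G y‖ₑ * rieszKernel x y ≤
      ENNReal.ofReal C₁ * (ENNReal.ofReal C₂ * I₁ + I₂) := by
    calc ∫⁻ y in Ω, ‖G y‖ₑ * rieszKernel x y
        ≤ ∫⁻ y in Ω, ENNReal.ofReal C₁ * ((∫⁻ z, h z * rieszKernel y z) * rieszKernel x y +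
          (∫⁻ θ, ENNReal.ofReal (compZeta Ω g y θ) ∂sphereMeasure n) * rieszKernel x y) := by
          refine lintegral_mono_ae ?_
          refine (ae_restrict_iff' hΩ.measurableSet).2 ?_
          filter_upwards [hgrad Ω hΩ u g G H hu hGm hHm hG hH hg] with y hy hyΩ
          rw [← add_mul, ← mul_assoc, ← ofReal_norm]
          gcongr
          exact hy hyΩ
      _ = ENNReal.ofReal C₁ *
          ((∫⁻ y in Ω, (∫⁻ z, h z * rieszKernel y z) * rieszKernel x y) + I₂) := by
          -- Measurability of the Hessian term alone splits the sum; joint measurability of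
          -- `compZeta` in `y` and `θ` is not needed.
          rw [lintegral_const_mul' _ _ ENNReal.ofReal_ne_top, lintegral_add_left hAk, e2]
      _ ≤ _ := by gcongr
  have e4 := sphereMeasure_mul_enorm_le (by omega) hΩ hu hGm hHm hG hH hx
  rw [← Real.norm_eq_abs, ofReal_norm]
  have e5 : S * ‖u x‖ₑ ≤ ENNReal.ofReal (C₁ * C₂ + C₁ + 1) * (I₁ + I₂ + I₃) := by
    refine (e4.trans (add_le_add le_rfl e3)).trans ?_
    rw [ENNReal.ofReal_add (by positivity) zero_le_one, ENNReal.ofReal_add (by positivity) hC₁.le,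
      ENNReal.ofReal_mul hC₁.le, ENNReal.ofReal_one]
    calc I₃ + ENNReal.ofReal C₁ * (ENNReal.ofReal C₂ * I₁ + I₂)
        = ENNReal.ofReal C₁ * ENNReal.ofReal C₂ * I₁ + ENNReal.ofReal C₁ * I₂ + 1 * I₃ := by ring
      _ ≤ ENNReal.ofReal C₁ * ENNReal.ofReal C₂ * (I₁ + I₂ + I₃) +
          ENNReal.ofReal C₁ * (I₁ + I₂ + I₃) + 1 * (I₁ + I₂ + I₃) := by
          gcongr
          · exact le_self_add.trans le_self_add
          · exact le_add_self.trans le_self_add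
          · exact le_add_self
      _ = _ := by ring
  rw [ENNReal.ofReal_div_of_pos hSpos, ENNReal.ofReal_toReal hStop, ENNReal.div_eq_inv_mul,
    mul_assoc]
  calc ‖u x‖ₑ = S⁻¹ * (S * ‖u x‖ₑ) := by
        rw [← mul_assoc, ENNReal.inv_mul_cancel hS0 hStop, one_mul]
    _ ≤ _ := by gcongr

end Pointwise

/-! ### Passage from the cone measure to Hausdorff measure, and the theorem. -/

theorem lintegral_sphereMeasure_le {C : ℝ}
    (hC : sphereMeasure n ≤ ENNReal.ofReal C •
      (μH[(n : ℝ) - 1] : Measure (Euc n)).restrict (sphere 0 1)) (f : Euc n → ℝ≥0∞) :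
    ∫⁻ θ, f θ ∂sphereMeasure n ≤
      ENNReal.ofReal C * ∫⁻ θ in sphere (0 : Euc n) 1, f θ ∂μH[(n : ℝ) - 1] := by
  rw [← smul_eq_mul, ← lintegral_smul_measure]
  exact lintegral_mono' hC le_rfl

end

theorem mainTheorem12 (n : ℕ) :
    (3 ≤ n → ∃ C : ℝ, 0 < C ∧
      ∀ (Ω : Set (EuclideanSpace ℝ (Fin n))), IsOpen Ω →
      ∀ (u : EuclideanSpace ℝ (Fin n) → ℝ),
        MemV2L1 Ω u → MemHajlaszV1L1 Ω u → MemCb Ω u →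
      ∀ (H : EuclideanSpace ℝ (Fin n) → Matrix (Fin n) (Fin n) ℝ), IsWeakHessian Ω u H →
      ∀ (g : EuclideanSpace ℝ (Fin n) → ℝ), IsHajlaszGradient Ω u g →
      ∀ x ∈ Ω,
        ENNReal.ofReal |u x| ≤ ENNReal.ofReal C *
          ((∫⁻ y in Ω, ENNReal.ofReal (matrixAbs (H y) / ‖x - y‖ ^ (n - 2)))
            + (∫⁻ y in Ω, ∫⁻ θ in Metric.sphere (0 : EuclideanSpace ℝ (Fin n)) 1,
                ENNReal.ofReal (compZeta Ω g y θ / ‖x - y‖ ^ (n - 1)) ∂μH[(n : ℝ) - 1])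
            + ∫⁻ θ in Metric.sphere (0 : EuclideanSpace ℝ (Fin n)) 1,
                ENNReal.ofReal |compZeta Ω u x θ| ∂μH[(n : ℝ) - 1])) ∧
    (2 ≤ n → ∃ C : ℝ, 0 < C ∧
      ∀ (Ω : Set (EuclideanSpace ℝ (Fin n))), IsOpen Ω →
      ∀ (u : EuclideanSpace ℝ (Fin n) → ℝ),
        MemV2L1 Ω u → MemHajlaszV1L1 Ω u → MemCb Ω u →
      ∀ (G : EuclideanSpace ℝ (Fin n) → EuclideanSpace ℝ (Fin n)), IsWeakGradient Ω u G →
      ∀ (H : EuclideanSpace ℝ (Fin n) → Matrix (Fin n) (Fin n) ℝ), IsWeakHessian Ω u H →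
      ∀ (g : EuclideanSpace ℝ (Fin n) → ℝ), IsHajlaszGradient Ω u g →
      ∀ᵐ x ∂(volume.restrict Ω),
        ENNReal.ofReal ‖G x‖ ≤ ENNReal.ofReal C *
          ((∫⁻ y in Ω, ENNReal.ofReal (matrixAbs (H y) / ‖x - y‖ ^ (n - 1)))
            + ∫⁻ θ in Metric.sphere (0 : EuclideanSpace ℝ (Fin n)) 1,
                ENNReal.ofReal (compZeta Ω g x θ) ∂μH[(n : ℝ) - 1])) := by

  refine ⟨fun hn => ?_, fun hn => ?_⟩
  · obtain ⟨C, hC, hmain⟩ := exists_pointwise_estimate hn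
    obtain ⟨D, hD, hσ⟩ := exists_sphereMeasure_le_hausdorffMeasure (n := n) (by omega)
    -- `D` pays for changing the measure in the spherical integrals, and `1` covers the Hessian
    -- term, which has none.
    refine ⟨C * (1 + D), by positivity, fun Ω hΩ u _ _ hu H hH g hg x hx => ?_⟩
    obtain ⟨G₀, hG₀, -⟩ := id hH
    obtain ⟨G, H', -, hHe, hGm, hHm, hG, hGH⟩ := exists_measurable_representatives hΩ hG₀ hH
    have h1 := hmain Ω hΩ u g G H' hu hGm hHm hG hGH hg x hx
    have e1 : ∫⁻ y in Ω, ENNReal.ofReal (matrixAbs (H' y) / ‖x - y‖ ^ (n - 2)) =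
        ∫⁻ y in Ω, ENNReal.ofReal (matrixAbs (H y) / ‖x - y‖ ^ (n - 2)) :=
      lintegral_congr_ae (by filter_upwards [hHe] with y hy; rw [hy])
    rw [e1] at h1
    refine h1.trans ?_
    rw [ENNReal.ofReal_mul hC.le, mul_assoc]
    refine mul_le_mul' le_rfl ?_
    rw [mul_add, mul_add]
    have hD1 : (1 : ENNReal) ≤ ENNReal.ofReal (1 + D) := ENNReal.one_le_ofReal.2 (by linarith)
    have hDD : ENNReal.ofReal D ≤ ENNReal.ofReal (1 + D) := ENNReal.ofReal_le_ofReal (by linarith)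
    refine add_le_add (add_le_add (le_mul_of_one_le_left' hD1) ?_) ?_
    · rw [← lintegral_const_mul' _ _ ENNReal.ofReal_ne_top]
      exact lintegral_mono fun y =>
        (lintegral_sphereMeasure_le hσ _).trans (mul_le_mul' hDD le_rfl)
    · exact (lintegral_sphereMeasure_le hσ _).trans (mul_le_mul' hDD le_rfl)
  · obtain ⟨C, hC, hmain⟩ := exists_gradient_estimate hn
    obtain ⟨D, hD, hσ⟩ := exists_sphereMeasure_le_hausdorffMeasure hn
    refine ⟨C * (1 + D), by positivity, fun Ω hΩ u _ _ hu G hG H hH g hg => ?_⟩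
    obtain ⟨G', H', hGe, hHe, hGm, hHm, hG', hGH⟩ := exists_measurable_representatives hΩ hG hH
    filter_upwards [hGe, ae_restrict_mem hΩ.measurableSet,
      ae_restrict_of_ae (hmain Ω hΩ u g G' H' hu hGm hHm hG' hGH hg)] with x hGx hxΩ h1
    have e1 : ∫⁻ y, Ω.indicator (fun y => ENNReal.ofReal (matrixAbs (H' y))) y * rieszKernel x y =
        ∫⁻ y in Ω, ENNReal.ofReal (matrixAbs (H y) / ‖x - y‖ ^ (n - 1)) := by
      have e2 : ∫⁻ y in Ω, ENNReal.ofReal (matrixAbs (H y) / ‖x - y‖ ^ (n - 1)) =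
          ∫⁻ y in Ω, ENNReal.ofReal (matrixAbs (H' y) / ‖x - y‖ ^ (n - 1)) :=
        lintegral_congr_ae (by filter_upwards [hHe] with y hy; rw [hy])
      rw [e2, ← lintegral_indicator hΩ.measurableSet]
      refine lintegral_congr fun y => ?_
      by_cases hy : y ∈ Ω
      · rw [indicator_of_mem hy, indicator_of_mem hy, rieszKernel,
          ← ENNReal.ofReal_mul (p := matrixAbs (H' y)) (Real.sqrt_nonneg _), mul_one_div]
      · rw [indicator_of_notMem hy, indicator_of_notMem hy, zero_mul]
    have h2 := h1 hxΩ
    rw [e1, ← hGx] at h2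
    refine h2.trans ?_
    rw [ENNReal.ofReal_mul hC.le, mul_assoc]
    refine mul_le_mul' le_rfl ?_
    rw [mul_add]
    refine add_le_add (le_mul_of_one_le_left' (ENNReal.one_le_ofReal.2 (by linarith))) ?_
    exact (lintegral_sphereMeasure_le hσ _).trans
      (mul_le_mul' (ENNReal.ofReal_le_ofReal (by linarith)) le_rfl)
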